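/- Let $c_0,c_1,c_2,c_3>0$ and $k_0,k_1,k_2,k_3\in\mathbb R$ with $c_1=c_3$, $k_1=k_3$. Put $\alpha_i=k_i+1$, $N=\alpha_0+\alpha_1+\alpha_2+\alpha_3$ and assume $N\neq0$. Let $p_i=c_iz^{k_i}$, $m=\operatorname{diag}(m_0,m_1,-m_1,-m_0)$ with $$m_0=\tfrac1{2N}(-3\alpha_0+2\alpha_1+\alpha_2),\qquad m_1=\tfrac1{2N}(-\alpha_0-2\alpha_1+3\alpha_2),$$ and $$\eta=\begin{pmatrix}0&0&0&p_0\\p_1&0&0&0\\0&p_2&0&0\\0&0&p_3&0\end{pmatrix},\qquad \hat\omega=\Big[-\tfrac4N\tfrac z{\lambda^2}\eta+\tfrac1\lambda m\Big]d\lambda .$$ Fix a point $z$ of the universal covering of $\mathbb C^\ast$ (that is, fix a value of $\log z$, and use it for all powers of $z$) such that $t=\tfrac4N(c_0c_1c_2c_3)^{1/4}z^{N/4}$ is real and positive; if $N>0$, any $z>0$ with real $\log z$ will do. Consider the system $$\frac{d\Phi}{d\lambda}=\Big[-\tfrac4N\tfrac z{\lambda^2}\eta^T+\tfrac1\lambda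 m\Big]\Phi. \tag{1}$$ Let $\omega=e^{\pi i/2}$, $\omega^a=e^{\pi ia/2}$, $d_4=\operatorname{diag}(1,\omega,\omega^2,\omega^3)$, $\Omega=(\omega^{ij})_{0\le i,j\le3}$, $h=\operatorname{diag}(h_0,h_1,h_1^{-1},h_0^{-1})$ with $h_0=p_0^{-3/8}p_1^{2/8}p_2^{1/8}$, $h_1=p_0^{-1/8}p_1^{-2/8}p_2^{3/8}$, and $O_0=h\Omega$. Let $\Phi_f=O_0\,(I+\sum_{j\ge1}C_j\lambda^j)\,e^{\frac t\lambda d_4}$ be the formal solution of (1) of this form. On the universal covering of $\mathbb C^\ast$ define, for $k\in\frac14\mathbb Z$, the sectors $$\Omega_k=\{\lambda : -\tfrac{3\pi}4-(k-1)\pi<\arg\lambda<\tfrac\pi2-(k-1)\pi\},$$ so that $\Omega_{k+\frac14}=e^{-\pi i/4}\Omega_k$. Let $\Phi_k$ be the holomorphic solution of (1) on $\Omega_k$ with $\Phi_k\sim\Phi_f$ (asymptotic expansion to all orders, uniform in closed subsectors) as $\lambda\to0$ in $\Omega_k$, and define the Stokes matrices $P_k$ by $\Phi_{k+\frac14}=\Phi_kP_k$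 on $\Omega_k\cap\Omega_{k+\frac14}$. Then the Stokes matrices $P_1$ and $P_{5/4}$ exist, are unique, and are $$P_1=\begin{pmatrix}1&0&0&0\\ \omega^{5/2}r_1^{\mathbb R}&1&0&0\\0&0&1&\omega^{-1/2}r_1^{\mathbb R}\\0&0&0&1\end{pmatrix},\qquad P_{5/4}=\begin{pmatrix}1&0&0&0\\0&1&0&\omega\, r_2^{\mathbb R}\\0&0&1&0\\0&0&0&1\end{pmatrix},$$ where $$r_1^{\mathbb R}=2\cos\tfrac\pi4(2m_0+3)+2\cos\tfrac\pi4(2m_1+1),\qquad r_2^{\mathbb R}=-2+2\cos\tfrac\pi2(m_0+m_1)+2\sin\tfrac\pi2(m_0-m_1).$$ There is no restriction on the $k_i$ other than $k_1=k_3$ and $N\ne0$. -/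

import Mathlib

open scoped BigOperators

namespace TTStarToda

noncomputable section

/-! Throughout, `c k : Fin 4 → ℝ` are the holomorphic data, i.e. `p_i = c_i z ^ k_i`, and
`l : ℂ` is a logarithm of `z`, i.e. a point of the universal covering of `ℂ \ {0}`, so that
`z = exp l` and `z ^ a = exp (a * l)`. The case `z > 0` is the case of real `l`. -/

/-- `N = α_0 + α_1 + α_2 + α_3`, where `α_i = k_i + 1`. -/
def N (k : Fin 4 → ℝ) : ℝ := ∑ i, (k i + 1)

/-- `p_i(z) = c_i z ^ k_i`. -/
def p (c k : Fin 4 → ℝ) (l : ℂ) (i : Fin 4) : ℂ :=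
  (c i : ℂ) * Complex.exp ((k i : ℂ) * l)

/-- The branch `c_i ^ a * z ^ (a * k_i)` of the real power `p_i ^ a`. -/
def pPow (c k : Fin 4 → ℝ) (l : ℂ) (i : Fin 4) (a : ℝ) : ℂ :=
  ((c i ^ a : ℝ) : ℂ) * Complex.exp ((a : ℂ) * (k i : ℂ) * l)

/-- The coordinate `t = (4 / N) (c_0 c_1 c_2 c_3) ^ (1/4) z ^ (N/4)`. -/
def t (c k : Fin 4 → ℝ) (l : ℂ) : ℂ :=
  (4 / N k : ℂ) * (((∏ i, c i) ^ (1 / 4 : ℝ) : ℝ) : ℂ) * Complex.exp ((N k : ℂ) / 4 * l)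

/-- The matrix `η` of the connection form `ω = (1/λ) η dz`. -/
def eta (c k : Fin 4 → ℝ) (l : ℂ) : Matrix (Fin 4) (Fin 4) ℂ :=
  !![0, 0, 0, p c k l 0;
     p c k l 1, 0, 0, 0;
     0, p c k l 2, 0, 0;
     0, 0, p c k l 3, 0]

/-- `h_0 = p_0^(-3/8) p_1^(2/8) p_2^(1/8)`. -/
def h0 (c k : Fin 4 → ℝ) (l : ℂ) : ℂ :=
  pPow c k l 0 (-3 / 8) * pPow c k l 1 (2 / 8) * pPow c k l 2 (1 / 8)

/-- `h_1 = p_0^(-1/8) p_1^(-2/8) p_2^(3/8)`. -/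
def h1 (c k : Fin 4 → ℝ) (l : ℂ) : ℂ :=
  pPow c k l 0 (-1 / 8) * pPow c k l 1 (-2 / 8) * pPow c k l 2 (3 / 8)

/-- `h = diag (h_0, h_1, h_2, h_3)`, where `h_2 = 1 / h_1` and `h_3 = 1 / h_0`. -/
def h (c k : Fin 4 → ℝ) (l : ℂ) : Matrix (Fin 4) (Fin 4) ℂ :=
  Matrix.diagonal ![h0 c k l, h1 c k l, (h1 c k l)⁻¹, (h0 c k l)⁻¹]

/-- `m_0 = (-3 α_0 + 2 α_1 + α_2) / (2 N)`; thus `h_0` is a constant times `t ^ m_0`. -/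
def m0 (k : Fin 4 → ℝ) : ℝ :=
  (-3 * (k 0 + 1) + 2 * (k 1 + 1) + (k 2 + 1)) / (2 * N k)

/-- `m_1 = (-α_0 - 2 α_1 + 3 α_2) / (2 N)`; thus `h_1` is a constant times `t ^ m_1`. -/
def m1 (k : Fin 4 → ℝ) : ℝ :=
  (-(k 0 + 1) - 2 * (k 1 + 1) + 3 * (k 2 + 1)) / (2 * N k)

/-- `m = diag (m_0, m_1, m_2, m_3)`, where `m_2 = -m_1` and `m_3 = -m_0`. -/
def m (k : Fin 4 → ℝ) : Matrix (Fin 4) (Fin 4) ℂ :=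
  Matrix.diagonal ![(m0 k : ℂ), (m1 k : ℂ), -(m1 k : ℂ), -(m0 k : ℂ)]

/-- The coefficient matrix `-(4/N) (z/λ²) ηᵀ + (1/λ) m` of the meromorphic linear system
`dΦ/dλ = [-(4/N) (z/λ²) ηᵀ + (1/λ) m] Φ` given by `\hat ω`. The first argument `lam` is `λ`. -/
def coeff (c k : Fin 4 → ℝ) (l lam : ℂ) : Matrix (Fin 4) (Fin 4) ℂ :=
  (-(4 / N k : ℂ) * (Complex.exp l / lam ^ 2)) • (eta c k l).transpose + (1 / lam) • m k

/-- `omegaPow a = ω ^ a = exp (π i a / 2)`, where `ω = exp (π i / 2)`. -/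
def omegaPow (a : ℝ) : ℂ := Complex.exp (Real.pi / 2 * Complex.I * a)

/-- `d_4 = diag (1, ω, ω², ω³)`. -/
def d4 : Matrix (Fin 4) (Fin 4) ℂ :=
  Matrix.diagonal fun j => omegaPow (j.val : ℝ)

/-- The matrix `Ω` with entries `ω ^ (i j)`, for `0 ≤ i, j ≤ 3`. -/
def Omega : Matrix (Fin 4) (Fin 4) ℂ :=
  Matrix.of fun i j => omegaPow ((i.val * j.val : ℕ) : ℝ)

/-- `O_0 = h Ω`, which diagonalizes `ηᵀ`. -/
def O0 (c k : Fin 4 → ℝ) (l : ℂ) : Matrix (Fin 4) (Fin 4) ℂ := h c k l * Omega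

/-- The formal series `Φ_f = O_0 (I + ∑_{j ≥ 1} C_j λ^j) exp ((t/λ) d_4)` is a formal solution at
`λ = 0` of the system with coefficient matrix `coeff`. After the factor `exp ((t/λ) d_4)` is
cancelled, the system for `F = O_0 ∑_j C_j λ^j` reads
`F' - (t/λ²) F d_4 = [-(4/N) (z/λ²) ηᵀ + (1/λ) m] F`; the coefficients of `λ^(-2)` and of
`λ^(j-1)`, `j ≥ 0`, are compared. -/
def IsFormalSolution (c k : Fin 4 → ℝ) (l : ℂ) (C : ℕ → Matrix (Fin 4) (Fin 4) ℂ) : Prop :=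
  C 0 = 1 ∧
  -(t c k l) • (O0 c k l * C 0 * d4)
    = (-(4 / N k : ℂ) * Complex.exp l) • ((eta c k l).transpose * (O0 c k l * C 0)) ∧
  ∀ j : ℕ,
    (j : ℂ) • (O0 c k l * C j) - t c k l • (O0 c k l * C (j + 1) * d4)
      = (-(4 / N k : ℂ) * Complex.exp l) • ((eta c k l).transpose * (O0 c k l * C (j + 1)))
        + m k * (O0 c k l * C j)

/-- The Stokes sector `Ω_κ`, in the universal covering of `ℂ \ {0}`, whose points are described by
`u = log λ`, so that `u.im` is the argument and `exp u.re` the modulus of `λ`. The sector `Ω_1` is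
`-3π/4 < arg λ < π/2`, and `Ω_{κ + 1/4} = exp (-π i / 4) Ω_κ`. -/
def sector (κ : ℝ) : Set ℂ :=
  {u | -(3 * Real.pi / 4) - (κ - 1) * Real.pi < u.im ∧
    u.im < Real.pi / 2 - (κ - 1) * Real.pi}

/-- The filter of `λ → 0` in the closed subsector `a ≤ arg λ ≤ b`, in the coordinate
`u = log λ`. -/
def zeroInSubsector (a b : ℝ) : Filter ℂ :=
  Filter.comap Complex.re Filter.atBot ⊓ Filter.principal {u | a ≤ u.im ∧ u.im ≤ b}

/-- `Φ ∼ O_0 (∑_j C_j λ^j) exp ((t/λ) d_4)` as `λ → 0` in the sector `Ω_κ`: an asymptotic expansion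
to all orders, uniform in every closed subsector. Here `λ = exp u`. -/
def HasExpansion (c k : Fin 4 → ℝ) (l : ℂ) (κ : ℝ) (C : ℕ → Matrix (Fin 4) (Fin 4) ℂ)
    (Φ : ℂ → Matrix (Fin 4) (Fin 4) ℂ) : Prop :=
  ∀ a b : ℝ, (∀ x ∈ Set.Icc a b, (x : ℂ) * Complex.I ∈ sector κ) →
    ∀ (n : ℕ) (i j : Fin 4),
      (fun u : ℂ =>
        (Φ u * Matrix.diagonal fun r : Fin 4 =>
            Complex.exp (-(t c k l / Complex.exp u * omegaPow (r.val : ℝ)))) i j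
          - (O0 c k l * ∑ q ∈ Finset.range n, Complex.exp u ^ q • C q) i j)
        =O[zeroInSubsector a b] fun u : ℂ => Complex.exp u ^ n

/-- `Φ` is the canonical solution `Φ_κ`: a holomorphic solution on the Stokes sector `Ω_κ` of the
linear system of `\hat ω` that is asymptotic to the formal solution as `λ → 0` in `Ω_κ`. In the
coordinate `u = log λ` the system is `dΦ/du = λ * coeff λ * Φ`. -/
def IsCanonicalSolution (c k : Fin 4 → ℝ) (l : ℂ) (κ : ℝ)
    (Φ : ℂ → Matrix (Fin 4) (Fin 4) ℂ) : Prop :=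
  (∀ u ∈ sector κ, ∀ i j : Fin 4,
    HasDerivAt (fun v => Φ v i j)
      ((Complex.exp u • (coeff c k l (Complex.exp u) * Φ u)) i j) u) ∧
  ∃ C, IsFormalSolution c k l C ∧ HasExpansion c k l κ C Φ

/-- `P` is the Stokes matrix `P_κ`, i.e. `Φ_{κ + 1/4} = Φ_κ P` (on `Ω_κ ∩ Ω_{κ + 1/4}`). This
includes the existence of the canonical solutions `Φ_κ` and `Φ_{κ + 1/4}`. -/
def IsStokesMatrix (c k : Fin 4 → ℝ) (l : ℂ) (κ : ℝ)
    (P : Matrix (Fin 4) (Fin 4) ℂ) : Prop :=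
  ∃ Φ Φ' : ℂ → Matrix (Fin 4) (Fin 4) ℂ,
    IsCanonicalSolution c k l κ Φ ∧ IsCanonicalSolution c k l (κ + 1 / 4) Φ' ∧
    ∀ u ∈ sector κ ∩ sector (κ + 1 / 4), Φ' u = Φ u * P

/-- The shape of `P_1`, with real Stokes parameter `r_1`. -/
def formP1 (r1 : ℝ) : Matrix (Fin 4) (Fin 4) ℂ :=
  !![1, 0, 0, 0;
     omegaPow (5 / 2) * r1, 1, 0, 0;
     0, 0, 1, omegaPow (-1 / 2) * r1;
     0, 0, 0, 1]

/-- The shape of `P_{5/4}`, with real Stokes parameter `r_2`. -/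
def formP54 (r2 : ℝ) : Matrix (Fin 4) (Fin 4) ℂ :=
  !![1, 0, 0, 0;
     0, 1, 0, omegaPow 1 * r2;
     0, 0, 1, 0;
     0, 0, 0, 1]

end

end TTStarToda

/-! Up to the constant gauge transformation by `h`, the system of `\hat ω` reads, in the coordinate
`x = t / λ = e^w`, `dY_i/dw = x Y_{i+1} - m_i Y_i` with cyclic indices (the model system). It has a
symmetry: if `Y` is a solution, so is `(i^k)^j Y_j(i^k x)` (`rotate`). Everything is expressed by the
rotations `G_k` of one solution `G = G_0`, the one that decays fastest on the positive real axis.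

*Asymptotics* (`exists_recessive_solution`). `G` is asymptotic to its formal solution
`e^{-x} ∑_q f_q x^{-q}` in the whole sector `|arg x| < 5π/4`. The proof is an energy estimate: along
a segment `x + r c` with `|arg c| ≤ π/4` the numerical range of `c (1 + Π)`, `Π` the cyclic shift,
lies in the right half plane, so the error of the asymptotic approximation at the beginning of the
segment is bounded by the error at its end (`energy_le`). On the positive real axis this yields the
existence of `G`, as a limit of solutions with initial data prescribed further and further away.
Points with `|arg x| < 3π/4` are joined by such segments to the positive real axis, and points with
`π/2 ≤ |arg x| < 5π/4` to one of the rays `arg x = ± π/2`.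

*Monodromy* (`rotate_relation`). By Cayley–Hamilton, five successive rotations of `G` satisfy a
linear relation whose coefficients are the symmetric functions of the eigenvalues of `rotate 1` on
the space of solutions. The characteristic polynomial can be computed from the transition matrix
from `w` to `w + π i / 2` as `Re w → -∞`, where the system becomes diagonal with constant
coefficients. Hence the eigenvalues are `i^j e^{-π i m_j / 2}`, without exception for resonant
exponents. Their elementary symmetric functions are the Stokes parameters, up to powers of `ω`
(`monodromy_relation_mVec`).

*Stokes matrices*. In each of the three sectors, three columns of the canonical solution are
rotations of `G`. The remaining column is a combination of two or three rotations, and its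
asymptotics are valid in the whole sector because the five-term monodromy relation expresses it in
two ways, each good in one part of the sector (`exists_model_canonical`). Comparing
the columns gives the Stokes matrices. They are unique because a sector of opening larger than `π`
determines the canonical solution (`canonicalSolution_unique`). -/

namespace TTStarToda

open Set Metric Filter Topology

noncomputable section

/-! ### Linear differential equations with entire coefficients -/

section EntireODE

variable {E : Type*} [NormedAddCommGroup E] [NormedSpace ℂ E]

theorem norm_picard_iterate_le {A : ℂ → E →L[ℂ] E} {v : E} {J : ℕ → ℂ → E}
    (h0 : ∀ w, J 0 w = v) (h1 : ∀ n, J (n + 1) 0 = 0)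
    (hJ : ∀ n w, HasDerivAt (J (n + 1)) (A w (J n w)) w) {R K : ℝ}
    (hK : ∀ w ∈ ball (0 : ℂ) R, ‖A w‖ ≤ K) (n : ℕ) :
    ∀ w ∈ ball (0 : ℂ) R, ‖J n w‖ ≤ ‖v‖ * (K * ‖w‖) ^ n / n.factorial := by
  induction n with
  | zero => intro w _; simp [h0]
  | succ n ih =>
    intro w hw
    have hK0 : 0 ≤ K := (norm_nonneg _).trans (hK w hw)
    have hball : ∀ s ∈ Icc (0 : ℝ) 1, (s : ℂ) * w ∈ ball (0 : ℂ) R := by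
      intro s hs
      rw [mem_ball_zero_iff] at hw ⊢
      rw [norm_mul, Complex.norm_real, Real.norm_of_nonneg hs.1]
      exact (mul_le_of_le_one_left (norm_nonneg _) hs.2).trans_lt hw
    have hder : ∀ s : ℝ, HasDerivAt (fun s : ℝ => J (n + 1) ((s : ℂ) * w))
        (w • A ((s : ℂ) * w) (J n ((s : ℂ) * w))) s := by
      intro s
      have h2 : HasDerivAt (fun s : ℝ => (s : ℂ) * w) w s := by
        simpa using (Complex.ofRealCLM.hasDerivAt (x := s)).mul_const w
      exact (hJ n ((s : ℂ) * w)).scomp s h2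
    have hB : ∀ s : ℝ, HasDerivAt
        (fun s : ℝ => ‖v‖ * (K * ‖w‖) ^ (n + 1) / (n + 1).factorial * s ^ (n + 1))
        (‖v‖ * (K * ‖w‖) ^ (n + 1) / (n + 1).factorial * (((n + 1 : ℕ) : ℝ) * s ^ n)) s := by
      intro s
      simpa using (hasDerivAt_pow (n + 1) s).const_mul
        (‖v‖ * (K * ‖w‖) ^ (n + 1) / (n + 1).factorial)
    have := image_norm_le_of_norm_deriv_right_le_deriv_boundary (a := 0) (b := 1)
      (f := fun s : ℝ => J (n + 1) ((s : ℂ) * w))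
      (fun s _ => (hder s).continuousAt.continuousWithinAt)
      (fun s _ => (hder s).hasDerivWithinAt) (by simp [h1]) hB ?_ (right_mem_Icc.2 zero_le_one)
    · simpa using this
    · intro s hs
      have hs' : s ∈ Icc (0 : ℝ) 1 := Ico_subset_Icc_self hs
      have e1 := ih _ (hball s hs')
      have e2 := hK _ (hball s hs')
      rw [norm_mul, Complex.norm_real, Real.norm_of_nonneg hs'.1] at e1
      calc ‖w • A ((s : ℂ) * w) (J n ((s : ℂ) * w))‖
          ≤ ‖w‖ * (K * (‖v‖ * (K * (s * ‖w‖)) ^ n / n.factorial)) := by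
            rw [norm_smul]
            gcongr
            exact (ContinuousLinearMap.le_opNorm _ _).trans (by gcongr)
        _ = _ := by
            rw [Nat.factorial_succ]
            push_cast
            have : (n.factorial : ℝ) ≠ 0 := by positivity
            have h' : (n : ℝ) + 1 ≠ 0 := by positivity
            field_simp
            ring

variable [CompleteSpace E]

theorem exists_entire_primitive {f : ℂ → E} (hf : Differentiable ℂ f) (y : E) :
    ∃ F : ℂ → E, F 0 = y ∧ ∀ w, HasDerivAt F (f w) w := by
  obtain ⟨F, hF⟩ := hf.isExactOn_univ.with_val_at 0 y
  exact ⟨F, hF.1, fun w => hF.2 w (mem_univ w)⟩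

/-- The Picard iterates, starting from the constant function with value `v`, of the linear equation
`Y' = A Y`; their sum is the solution with value `v` at `0`. -/
theorem exists_picard_iterates {A : ℂ → E →L[ℂ] E} (hA : Differentiable ℂ A) (v : E) :
    ∃ J : ℕ → ℂ → E, (∀ w, J 0 w = v) ∧ (∀ n, J (n + 1) 0 = 0) ∧
      ∀ n w, HasDerivAt (J (n + 1)) (A w (J n w)) w := by
  have step : ∀ f : {f : ℂ → E // Differentiable ℂ f},
      ∃ g : {g : ℂ → E // Differentiable ℂ g}, g.1 0 = 0 ∧
        ∀ w, HasDerivAt g.1 (A w (f.1 w)) w := by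
    intro f
    obtain ⟨F, hF0, hF⟩ := exists_entire_primitive (hA.clm_apply f.2) (0 : E)
    exact ⟨⟨F, fun w => (hF w).differentiableAt⟩, hF0, hF⟩
  choose S hS0 hS using step
  let J : ℕ → {f : ℂ → E // Differentiable ℂ f} := fun n =>
    Nat.rec ⟨fun _ => v, differentiable_const v⟩ (fun _ f => S f) n
  exact ⟨fun n => (J n).1, fun w => rfl, fun n => hS0 (J n), fun n w => hS (J n) w⟩

/-- A linear differential equation `Y' = A Y` with entire coefficient has an entire solution with
any prescribed value at `0`. -/
theorem exists_entire_solution {A : ℂ → E →L[ℂ] E} (hA : Differentiable ℂ A) (v : E) :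
    ∃ Y : ℂ → E, Y 0 = v ∧ ∀ w, HasDerivAt Y (A w (Y w)) w := by
  obtain ⟨J, h0, h1, hJ⟩ := exists_picard_iterates hA v
  have bound : ∀ R : ℝ, ∃ K : ℝ, 0 ≤ K ∧ ∀ w ∈ ball (0 : ℂ) R, ‖A w‖ ≤ K := by
    intro R
    obtain ⟨K, hK⟩ := (isCompact_closedBall (0 : ℂ) R).exists_bound_of_continuousOn
      hA.continuous.continuousOn
    exact ⟨max K 0, le_max_right _ _, fun w hw =>
      (hK w (ball_subset_closedBall hw)).trans (le_max_left _ _)⟩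
  have term : ∀ R : ℝ, 0 < R → ∃ u : ℕ → ℝ, Summable u ∧
      ∀ n, ∀ w ∈ ball (0 : ℂ) R, ‖J n w‖ ≤ u n := by
    intro R hR
    obtain ⟨K, hK0, hK⟩ := bound R
    refine ⟨fun n => ‖v‖ * ((K * R) ^ n / n.factorial),
      (Real.summable_pow_div_factorial (K * R)).mul_left _, fun n w hw => ?_⟩
    refine (norm_picard_iterate_le h0 h1 hJ hK n w hw).trans ?_
    rw [mul_div_assoc]
    have : ‖w‖ ≤ R := (mem_ball_zero_iff.1 hw).le
    show _ ≤ ‖v‖ * ((K * R) ^ n / n.factorial)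
    gcongr
  have hsum : ∀ w, Summable fun n => J n w := by
    intro w
    obtain ⟨u, hu, hub⟩ := term (‖w‖ + 1) (by positivity)
    exact .of_norm_bounded hu fun n => hub n w (by simp)
  refine ⟨fun w => ∑' n, J n w, ?_, fun w => ?_⟩
  · show ∑' n, J n 0 = v
    rw [tsum_eq_single 0]
    · exact h0 0
    · intro n hn
      obtain ⟨k, rfl⟩ := Nat.exists_eq_succ_of_ne_zero hn
      exact h1 k
  · obtain ⟨u, hu, hub⟩ := term (‖w‖ + 1) (by positivity)
    obtain ⟨K, hK0, hK⟩ := bound (‖w‖ + 1)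
    have hw : w ∈ ball (0 : ℂ) (‖w‖ + 1) := by simp
    have key := hasDerivAt_tsum_of_isPreconnected (g := fun n => J (n + 1))
      (g' := fun n z => A z (J n z)) (hu.mul_left K) isOpen_ball
      (convex_ball (0 : ℂ) (‖w‖ + 1)).isPreconnected (fun n y _ => hJ n y)
      (fun n y hy => (ContinuousLinearMap.le_opNorm _ _).trans
        (mul_le_mul (hK y hy) (hub n y hy) (norm_nonneg _) hK0)) hw
      ((summable_nat_add_iff 1).2 (hsum w)) hw
    have e : (fun z => ∑' n, J n z) = fun z => v + ∑' n, J (n + 1) z := by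
      funext z
      rw [(hsum z).tsum_eq_zero_add, h0]
    show HasDerivAt (fun z => ∑' n, J n z) (A w (∑' n, J n w)) w
    rw [e, (A w).map_tsum (hsum w)]
    simpa using key.const_add v

end EntireODE

section Matrix

theorem hasDerivAt_matrix_mul {n : Type*} [Fintype n] {X Y X' Y' : ℂ → Matrix n n ℂ} {w : ℂ}
    (hX : ∀ i j, HasDerivAt (fun v => X v i j) (X' w i j) w)
    (hY : ∀ i j, HasDerivAt (fun v => Y v i j) (Y' w i j) w) (i j : n) :
    HasDerivAt (fun v => (X v * Y v) i j) ((X' w * Y w + X w * Y' w) i j) w := by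
  simp only [Matrix.mul_apply, Matrix.add_apply, ← Finset.sum_add_distrib]
  exact HasDerivAt.fun_sum fun k _ => (hX i k).mul (hY k j)

theorem eq_of_hasDerivAt_zero_of_convex {f : ℂ → ℂ} {s : Set ℂ} (hs : Convex ℝ s)
    (hf : ∀ w ∈ s, HasDerivAt f 0 w) {x y : ℂ} (hx : x ∈ s) (hy : y ∈ s) : f x = f y := by
  have := hs.norm_image_sub_le_of_norm_hasDerivWithin_le (C := 0)
    (fun w hw => (hf w hw).hasDerivWithinAt) (fun w _ => by simp) hy hx
  simpa [sub_eq_zero] using this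

variable {n : Type*} [Fintype n] [DecidableEq n]

theorem exists_matrix_solution {A : ℂ → Matrix n n ℂ}
    (hA : ∀ i j, Differentiable ℂ fun w => A w i j) :
    ∃ W : ℂ → Matrix n n ℂ, W 0 = 1 ∧
      ∀ w i j, HasDerivAt (fun v => W v i j) ((A w * W w) i j) w := by
  let B : ℂ → (n → ℂ) →L[ℂ] (n → ℂ) := fun w =>
    ∑ i, ∑ j, A w i j • ContinuousLinearMap.smulRight
      (ContinuousLinearMap.proj (R := ℂ) (φ := fun _ : n => ℂ) j) (Pi.single i (1 : ℂ))
  have hB : Differentiable ℂ B := by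
    refine Differentiable.fun_sum fun i _ => Differentiable.fun_sum fun j _ => ?_
    exact (hA i j).smul_const _
  have hBv : ∀ w v i, B w v i = ∑ j, A w i j * v j := by
    intro w v i
    simp only [B, sum_apply, smul_apply,
      ContinuousLinearMap.smulRight_apply, ContinuousLinearMap.proj_apply, Finset.sum_apply,
      Pi.smul_apply, Pi.single_apply, smul_eq_mul]
    rw [Finset.sum_eq_single i]
    · simp
    · intro k _ hk; simp [hk.symm]
    · simp
  choose Y hY0 hY using fun j : n => exists_entire_solution hB (Pi.single j (1 : ℂ))
  refine ⟨fun w => Matrix.of fun i j => Y j w i, ?_, fun w i j => ?_⟩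
  · ext i j
    simp [hY0, Pi.single_apply, Matrix.one_apply]
  · have := hasDerivAt_pi.1 (hY j w) i
    rw [hBv] at this
    simpa [Matrix.mul_apply] using this

/-- A linear matrix equation `W' = A W` with entire coefficient has an entire fundamental solution.
Its inverse `V` is the solution of the adjoint equation `V' = - V A`. -/
theorem exists_fundamental_matrix {A : ℂ → Matrix n n ℂ}
    (hA : ∀ i j, Differentiable ℂ fun w => A w i j) :
    ∃ W V : ℂ → Matrix n n ℂ,
      (∀ w i j, HasDerivAt (fun v => W v i j) ((A w * W w) i j) w) ∧
      (∀ w i j, HasDerivAt (fun v => V v i j) ((-(V w * A w)) i j) w) ∧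
      (∀ w, V w * W w = 1) ∧ ∀ w, W w * V w = 1 := by
  obtain ⟨W, hW0, hW⟩ := exists_matrix_solution hA
  obtain ⟨U, hU0, hU⟩ := exists_matrix_solution (A := fun w => -(A w).transpose)
    (fun i j => (hA j i).neg)
  have hV : ∀ w i j, HasDerivAt (fun v => (U v).transpose i j)
      ((-((U w).transpose * A w)) i j) w := by
    intro w i j
    convert! hU w j i using 1
    simp [Matrix.mul_apply, mul_comm]
  have hVW : ∀ w, (U w).transpose * W w = 1 := by
    intro w
    ext i j
    have hd : ∀ w ∈ univ, HasDerivAt (fun v => ((U v).transpose * W v) i j) 0 w := by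
      intro w _
      convert! hasDerivAt_matrix_mul (X' := fun w => -((U w).transpose * A w))
        (Y' := fun w => A w * W w) (hV w) (hW w) i j using 1
      simp [Matrix.mul_assoc]
    rw [eq_of_hasDerivAt_zero_of_convex convex_univ hd (mem_univ w) (mem_univ 0)]
    simp [hW0, hU0]
  exact ⟨W, fun w => (U w).transpose, hW, hV, hVW, fun w => mul_eq_one_comm.1 (hVW w)⟩

end Matrix

/-! ### The model system and its recessive formal solution -/

/-- The model system `Y_i' = e^w Y_{i+1} - μ_i Y_i` (indices modulo `4`) in the coordinate
`w = log x`, `x = t / λ`. It is the system of `\hat ω` after the constant gauge transformation by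
`h`. Solutions are required on the whole `w`-plane, i.e. on the universal covering of the punctured
`x`-plane. -/
def IsModelSolution (μ : Fin 4 → ℝ) (Y : ℂ → Fin 4 → ℂ) : Prop :=
  ∀ w i, HasDerivAt (fun v => Y v i) (Complex.exp w * Y w (i + 1) - μ i * Y w i) w

/-- The coefficients `f_q` of the formal solution `e^{-x} ∑_q f_q x^{-q}` of the model system. The
system determines `f_{q+1}` from `(f_{q+1})_i + (f_{q+1})_{i+1} = (μ_i - q) (f_q)_i` up to a multiple
of `(1, -1, 1, -1)`, and the multiple is fixed by the solvability of the equation for `f_{q+2}`. -/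
def formalCoeff (μ : Fin 4 → ℝ) : ℕ → Fin 4 → ℂ
  | 0 => ![1, -1, 1, -1]
  | q + 1 =>
    let v : Fin 4 → ℂ := fun i => (μ i - q) * formalCoeff μ q i
    let s : ℂ := (-(μ 1 - (q + 1)) * v 0 + (μ 2 - (q + 1)) * (v 1 - v 0)
      - (μ 3 - (q + 1)) * (v 2 - v 1 + v 0)) / (4 * (q + 1))
    ![s, v 0 - s, v 1 - v 0 + s, v 2 - v 1 + v 0 - s]

theorem formalCoeff_alternating {μ : Fin 4 → ℝ} (hμ : ∑ i, μ i = 0) (q : ℕ) :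
    (μ 0 - q) * formalCoeff μ q 0 - (μ 1 - q) * formalCoeff μ q 1
      + (μ 2 - q) * formalCoeff μ q 2 - (μ 3 - q) * formalCoeff μ q 3 = 0 := by
  have hμ' : (μ 0 + μ 1 + μ 2 + μ 3 : ℂ) = 0 := by
    rw [Fin.sum_univ_four] at hμ
    exact_mod_cast hμ
  cases q with
  | zero => simp [formalCoeff]; linear_combination hμ'
  | succ q =>
    have hq : (q : ℂ) + 1 ≠ 0 := Nat.cast_add_one_ne_zero q
    simp only [formalCoeff]
    simp only [Matrix.cons_val]
    push_cast
    field_simp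
    have h3 : (μ 3 : ℂ) = -(μ 0 + μ 1 + μ 2) := by linear_combination hμ'
    rw [h3]
    ring

theorem formalCoeff_succ {μ : Fin 4 → ℝ} (hμ : ∑ i, μ i = 0) (q : ℕ) (i : Fin 4) :
    formalCoeff μ (q + 1) i + formalCoeff μ (q + 1) (i + 1)
      = (μ i - q) * formalCoeff μ q i := by
  have h := formalCoeff_alternating hμ q
  fin_cases i
  · simp [formalCoeff]
  · simp [formalCoeff]
  · simp [formalCoeff]
  · simp [formalCoeff]
    linear_combination h

/-- The truncation `∑_{q < n} f_q x^{-q}` of the formal series. -/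
def truncation (μ : Fin 4 → ℝ) (n : ℕ) (w : ℂ) (i : Fin 4) : ℂ :=
  ∑ q ∈ Finset.range n, formalCoeff μ q i * Complex.exp (-w) ^ q

theorem hasDerivAt_truncation {μ : Fin 4 → ℝ} (hμ : ∑ i, μ i = 0) (n : ℕ) (w : ℂ) (i : Fin 4) :
    HasDerivAt (fun v => truncation μ (n + 1) v i)
      (Complex.exp w * (truncation μ (n + 1) w i + truncation μ (n + 1) w (i + 1))
        - μ i * truncation μ (n + 1) w i
        + (μ i - n) * formalCoeff μ n i * Complex.exp (-w) ^ n) w := by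
  induction n with
  | zero =>
    have h0 : formalCoeff μ 0 i + formalCoeff μ 0 (i + 1) = 0 := by
      fin_cases i <;> simp [formalCoeff]
    simp only [truncation, zero_add, Finset.range_one, Finset.sum_singleton, pow_zero, mul_one]
    rw [h0]
    convert! hasDerivAt_const w (formalCoeff μ 0 i) using 1
    simp
  | succ n ih =>
    have e : ∀ v j, truncation μ (n + 1 + 1) v j
        = truncation μ (n + 1) v j + formalCoeff μ (n + 1) j * Complex.exp (-v) ^ (n + 1) :=
      fun v j => Finset.sum_range_succ _ _
    have hd : HasDerivAt (fun v : ℂ => formalCoeff μ (n + 1) i * Complex.exp (-v) ^ (n + 1))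
        (formalCoeff μ (n + 1) i * (-((n : ℂ) + 1) * Complex.exp (-w) ^ (n + 1))) w := by
      have h1 : HasDerivAt (fun v : ℂ => Complex.exp (-v)) (Complex.exp (-w) * -1) w :=
        (hasDerivAt_neg w).cexp
      convert! (h1.pow (n + 1)).const_mul (formalCoeff μ (n + 1) i) using 1
      push_cast
      simp
      ring
    simp only [e]
    convert! ih.add hd using 1
    have h := formalCoeff_succ hμ n i
    have hx : Complex.exp w * Complex.exp (-w) ^ (n + 1) = Complex.exp (-w) ^ n := by
      rw [pow_succ, mul_comm, mul_assoc, ← Complex.exp_add, neg_add_cancel, Complex.exp_zero,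
        mul_one]
    push_cast
    linear_combination Complex.exp (-w) ^ n * h
      + (formalCoeff μ (n + 1) i + formalCoeff μ (n + 1) (i + 1)) * hx

/-- The error `e^x Y - ∑_{q < n} f_q x^{-q}` of the asymptotic approximation of `Y`. -/
def asymError (μ : Fin 4 → ℝ) (Y : ℂ → Fin 4 → ℂ) (n : ℕ) (w : ℂ) (i : Fin 4) : ℂ :=
  Complex.exp (Complex.exp w) * Y w i - truncation μ n w i

theorem hasDerivAt_asymError {μ : Fin 4 → ℝ} (hμ : ∑ i, μ i = 0) {Y : ℂ → Fin 4 → ℂ}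
    (hY : IsModelSolution μ Y) (n : ℕ) (w : ℂ) (i : Fin 4) :
    HasDerivAt (fun v => asymError μ Y (n + 1) v i)
      (Complex.exp w * (asymError μ Y (n + 1) w i + asymError μ Y (n + 1) w (i + 1))
        - μ i * asymError μ Y (n + 1) w i
        - (μ i - n) * formalCoeff μ n i * Complex.exp (-w) ^ n) w := by
  have h1 : HasDerivAt (fun v => Complex.exp (Complex.exp v))
      (Complex.exp (Complex.exp w) * Complex.exp w) w := (Complex.hasDerivAt_exp w).cexp
  convert! (h1.mul (hY w i)).sub (hasDerivAt_truncation hμ n w i) using 1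
  simp only [asymError]
  ring

/-! ### The energy estimate -/

/-- The eigenvalues `1 + ω^k` of `1 + Π`, with `Π` the cyclic shift, lie in the sector
`|arg| ≤ π/4`; since `1 + Π` is normal, so does its numerical range. -/
theorem abs_im_shift_le (a : Fin 4 → ℂ) :
    |(∑ i, star (a i) * (a i + a (i + 1))).im| ≤ (∑ i, star (a i) * (a i + a (i + 1))).re := by
  have s1 := Complex.normSq_nonneg (a 0 + a 1 + a 2 + a 3)
  have s2 := Complex.normSq_nonneg (a 0 + Complex.I * a 1 - a 2 - Complex.I * a 3)
  have s3 := Complex.normSq_nonneg (a 0 - Complex.I * a 1 - a 2 + Complex.I * a 3)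
  simp only [Complex.normSq_apply, Complex.add_re, Complex.add_im, Complex.sub_re, Complex.sub_im,
    Complex.mul_re, Complex.mul_im, Complex.I_re, Complex.I_im] at s1 s2 s3
  rw [abs_le]
  simp only [Fin.sum_univ_four, Fin.isValue, Fin.reduceAdd, zero_add, Complex.add_re,
    Complex.add_im, Complex.mul_re, Complex.mul_im, Complex.star_def, Complex.conj_re,
    Complex.conj_im]
  constructor <;> nlinarith

theorem re_shift_nonneg {c : ℂ} (hc : |c.im| ≤ c.re) (a : Fin 4 → ℂ) :
    0 ≤ (c * ∑ i, star (a i) * (a i + a (i + 1))).re := by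
  have h := abs_im_shift_le a
  rw [Complex.mul_re]
  have h1 : |c.im| * |(∑ i, star (a i) * (a i + a (i + 1))).im|
      ≤ c.re * (∑ i, star (a i) * (a i + a (i + 1))).re :=
    mul_le_mul hc h (abs_nonneg _) ((abs_nonneg _).trans hc)
  rw [← abs_mul] at h1
  linarith [le_abs_self (c.im * (∑ i, star (a i) * (a i + a (i + 1))).im)]

/-- The energy `∑ |e_i|²`, weighted by a power of `ρ = ρ₀ + r`, of a solution of a perturbation of
`e' = c (1 + Π) e` is nondecreasing, up to the contribution of the inhomogeneous term. So `e` is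
controlled at the beginning of the path by its size at the end. -/
theorem energy_le {c : ℂ} (hc : |c.im| ≤ c.re) {ρ₀ r₁ b g : ℝ} (hρ : 0 < ρ₀) (hr : 0 ≤ r₁)
    {B k n : ℕ} (hb : 2 * b ≤ B) (hk : 0 < k) (hn : 2 * n = B + 1 + k) {e H : ℝ → Fin 4 → ℂ}
    (he : ∀ r ∈ Icc 0 r₁, ∀ i,
      HasDerivAt (fun r => e r i) (c * (e r i + e r (i + 1)) + H r i) r)
    (hH : ∀ r ∈ Icc 0 r₁, ∀ i,
      ‖H r i‖ ≤ (b * ‖e r i‖ + g * ((ρ₀ + r)⁻¹) ^ n) * (ρ₀ + r)⁻¹) :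
    ρ₀ ^ (B + 1) * ∑ i, ‖e 0 i‖ ^ 2
      ≤ (ρ₀ + r₁) ^ (B + 1) * ∑ i, ‖e r₁ i‖ ^ 2 + 4 * g ^ 2 / k * (ρ₀⁻¹) ^ k := by
  have hpos : ∀ r ∈ Icc 0 r₁, 0 < ρ₀ + r := fun r hr => by linarith [hr.1]
  have hkR : (0 : ℝ) < k := by exact_mod_cast hk
  have hy : ∀ r ∈ Icc 0 r₁, HasDerivAt (fun r => ∑ i, ‖e r i‖ ^ 2)
      (∑ i, 2 * inner ℝ (e r i) (c * (e r i + e r (i + 1)) + H r i)) r := fun r hr =>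
    HasDerivAt.fun_sum fun i _ => (he r hr i).norm_sq
  have hy' : ∀ r ∈ Icc 0 r₁,
      -((2 * b + 1) * ∑ i, ‖e r i‖ ^ 2 + 4 * g ^ 2 * ((ρ₀ + r)⁻¹) ^ (2 * n)) * (ρ₀ + r)⁻¹
        ≤ ∑ i, 2 * inner ℝ (e r i) (c * (e r i + e r (i + 1)) + H r i) := by
    intro r hr
    have hp := inv_pos.2 (hpos r hr)
    have h1 : 0 ≤ ∑ i, inner ℝ (e r i) (c * (e r i + e r (i + 1))) := by
      convert! re_shift_nonneg hc (e r) using 1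
      rw [Finset.mul_sum, Complex.re_sum]
      refine Finset.sum_congr rfl fun i _ => ?_
      rw [Complex.inner, Complex.star_def]
      congr 1
      ring
    have h2 : ∀ i, -((2 * b + 1) * ‖e r i‖ ^ 2 + g ^ 2 * ((ρ₀ + r)⁻¹) ^ (2 * n)) * (ρ₀ + r)⁻¹
        ≤ 2 * inner ℝ (e r i) (H r i) := by
      intro i
      have i1 : -(‖e r i‖ * ‖H r i‖) ≤ inner ℝ (e r i) (H r i) :=
        (abs_le.1 (abs_real_inner_le_norm (e r i) (H r i))).1
      have i2 : ‖e r i‖ * ‖H r i‖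
          ≤ ‖e r i‖ * ((b * ‖e r i‖ + g * ((ρ₀ + r)⁻¹) ^ n) * (ρ₀ + r)⁻¹) :=
        mul_le_mul_of_nonneg_left (hH r hr i) (norm_nonneg _)
      have i3 : 0 ≤ (‖e r i‖ - g * ((ρ₀ + r)⁻¹) ^ n) ^ 2 * (ρ₀ + r)⁻¹ := by positivity
      have i4 : ((ρ₀ + r)⁻¹) ^ (2 * n) = (((ρ₀ + r)⁻¹) ^ n) ^ 2 := by rw [mul_comm, pow_mul]
      rw [i4]
      nlinarith
    have h3 := Finset.sum_le_sum fun i (_ : i ∈ Finset.univ) => h2 i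
    have h4 : ∑ i, 2 * inner ℝ (e r i) (c * (e r i + e r (i + 1)) + H r i)
        = 2 * ∑ i, inner ℝ (e r i) (c * (e r i + e r (i + 1)))
          + ∑ i, 2 * inner ℝ (e r i) (H r i) := by
      rw [Finset.mul_sum, ← Finset.sum_add_distrib]
      refine Finset.sum_congr rfl fun i _ => ?_
      rw [inner_add_right]; ring
    rw [h4]
    refine le_trans (le_of_eq ?_) (h3.trans (by linarith))
    simp only [Fin.sum_univ_four]
    ring
  -- the second term is a primitive of the contribution of the inhomogeneous term
  let Φ : ℝ → ℝ := fun r =>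
    (ρ₀ + r) ^ (B + 1) * ∑ i, ‖e r i‖ ^ 2 - 4 * g ^ 2 / k * ((ρ₀ + r)⁻¹) ^ k
  have hΦ : ∀ r ∈ Icc 0 r₁, ∃ d, 0 ≤ d ∧ HasDerivAt Φ d r := by
    intro r hr
    have hp := hpos r hr
    have d0 : HasDerivAt (fun r => ρ₀ + r) 1 r := (hasDerivAt_id r).const_add ρ₀
    have d1 := (d0.pow (B + 1)).mul (hy r hr)
    have d2 := ((d0.inv hp.ne').pow k).const_mul (4 * g ^ 2 / k)
    refine ⟨_, ?_, d1.sub d2⟩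
    simp only [Pi.pow_apply, Pi.inv_apply, add_tsub_cancel_right, mul_one, Nat.cast_add,
      Nat.cast_one]
    obtain ⟨j, rfl⟩ := Nat.exists_eq_succ_of_ne_zero hk.ne'
    have hS : 0 ≤ ∑ i, ‖e r i‖ ^ 2 := Finset.sum_nonneg fun i _ => by positivity
    have i1 := mul_le_mul_of_nonneg_left (hy' r hr) (pow_pos hp (B + 1)).le
    have i2 : (ρ₀ + r) ^ (B + 1) * (ρ₀ + r)⁻¹ = (ρ₀ + r) ^ B := by
      rw [pow_succ, mul_assoc, mul_inv_cancel₀ hp.ne', mul_one]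
    have i3 : (ρ₀ + r) ^ B * ((ρ₀ + r)⁻¹) ^ (2 * n) = ((ρ₀ + r)⁻¹) ^ (j + 2) := by
      rw [hn, show B + 1 + j.succ = B + (j + 2) by omega, pow_add, ← mul_assoc, ← mul_pow,
        mul_inv_cancel₀ hp.ne', one_pow, one_mul]
    have i4 : 0 ≤ (B - 2 * b) * ((ρ₀ + r) ^ B * ∑ i, ‖e r i‖ ^ 2) :=
      mul_nonneg (by linarith) (by positivity)
    have i5 : 4 * g ^ 2 / ((j.succ : ℕ) : ℝ) * (((j.succ : ℕ) : ℝ) * ((ρ₀ + r)⁻¹) ^ (j.succ - 1)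
        * (-1 / (ρ₀ + r) ^ 2)) = -(4 * g ^ 2 * ((ρ₀ + r)⁻¹) ^ (j + 2)) := by
      have : ((j.succ : ℕ) : ℝ) ≠ 0 := hkR.ne'
      rw [Nat.succ_sub_one, pow_add, inv_pow _ 2]
      field_simp
    rw [i5]
    have i6 : (ρ₀ + r) ^ (B + 1) *
        (-((2 * b + 1) * ∑ i, ‖e r i‖ ^ 2 + 4 * g ^ 2 * ((ρ₀ + r)⁻¹) ^ (2 * n)) * (ρ₀ + r)⁻¹)
        = -(2 * b + 1) * ((ρ₀ + r) ^ B * ∑ i, ‖e r i‖ ^ 2)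
          - 4 * g ^ 2 * ((ρ₀ + r)⁻¹) ^ (j + 2) := by
      rw [← i3, ← i2]; ring
    rw [i6] at i1
    linarith
  have hmono : MonotoneOn Φ (Icc 0 r₁) := by
    refine monotoneOn_of_deriv_nonneg (convex_Icc 0 r₁) (fun r hr => ?_) (fun r hr => ?_)
      (fun r hr => ?_)
    · obtain ⟨d, _, hd⟩ := hΦ r hr
      exact hd.continuousAt.continuousWithinAt
    · obtain ⟨d, _, hd⟩ := hΦ r (interior_subset hr)
      exact hd.differentiableAt.differentiableWithinAt
    · obtain ⟨d, hd0, hd⟩ := hΦ r (interior_subset hr)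
      rw [hd.deriv]; exact hd0
  have hfin := hmono (left_mem_Icc.2 hr) (right_mem_Icc.2 hr) hr
  simp only [Φ, add_zero] at hfin
  have : 0 ≤ 4 * g ^ 2 / k * ((ρ₀ + r₁)⁻¹) ^ k := by
    have := hpos r₁ (right_mem_Icc.2 hr)
    positivity
  linarith

/-- The energy estimate along the segment from `x = e^w` to `x + r₁ c`, lifted to the universal
covering. The constants do not depend on the solution, nor on the segment as long as it stays away
from the origin in the sense of `κ`. -/
theorem exists_energy_bound {μ : Fin 4 → ℝ} (hμ : ∑ i, μ i = 0) {κ : ℝ} (hκ : 0 < κ) :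
    ∃ B : ℕ, ∀ n k : ℕ, 0 < k → 2 * n = B + 1 + k → ∃ C : ℝ, 0 ≤ C ∧
      ∀ Y, IsModelSolution μ Y → ∀ (w c : ℂ) (r₁ : ℝ), ‖c‖ = 1 → |c.im| ≤ c.re → 0 ≤ r₁ →
        (∀ r ∈ Icc 0 r₁, κ * (‖Complex.exp w‖ + r) ≤ ‖Complex.exp w + r * c‖ ∧
          1 + r * c / Complex.exp w ∈ Complex.slitPlane) →
        ‖Complex.exp w‖ ^ (B + 1) * ∑ i, ‖asymError μ Y (n + 1) w i‖ ^ 2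
          ≤ (‖Complex.exp w‖ + r₁) ^ (B + 1) *
              ∑ i, ‖asymError μ Y (n + 1) (w + Complex.log (1 + r₁ * c / Complex.exp w)) i‖ ^ 2
            + C * (‖Complex.exp w‖⁻¹) ^ k := by
  let S : ℝ := ∑ i, |μ i|
  have hS : ∀ i, |μ i| ≤ S := fun i =>
    Finset.single_le_sum (f := fun i => |μ i|) (fun i _ => abs_nonneg _) (Finset.mem_univ i)
  refine ⟨⌈2 * (S / κ)⌉₊, fun n k hk hn => ?_⟩
  let G : ℝ := ∑ i, ‖(μ i - n : ℂ) * formalCoeff μ n i‖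
  have hG : ∀ i, ‖(μ i - n : ℂ) * formalCoeff μ n i‖ ≤ G := fun i =>
    Finset.single_le_sum (f := fun i => ‖(μ i - n : ℂ) * formalCoeff μ n i‖)
      (fun i _ => norm_nonneg _) (Finset.mem_univ i)
  refine ⟨4 * (G * κ⁻¹ ^ (n + 1)) ^ 2 / k, by positivity, ?_⟩
  intro Y hY w c r₁ hc1 hc hr₁ hpath
  have hx : Complex.exp w ≠ 0 := Complex.exp_ne_zero w
  have hx0 : 0 < ‖Complex.exp w‖ := norm_pos_iff.2 hx
  -- the lift of the segment to the universal covering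
  let γ : ℝ → ℂ := fun r => w + Complex.log (1 + r * c / Complex.exp w)
  have hγexp : ∀ r ∈ Icc 0 r₁, Complex.exp (γ r) = Complex.exp w + r * c := by
    intro r hr
    have h0 : 1 + r * c / Complex.exp w ≠ 0 := Complex.slitPlane_ne_zero (hpath r hr).2
    simp only [γ]
    rw [Complex.exp_add, Complex.exp_log h0]
    field_simp
  have hγ : ∀ r ∈ Icc 0 r₁, HasDerivAt γ (c / Complex.exp (γ r)) r := by
    intro r hr
    have h0 := (hpath r hr).2
    have h1 : HasDerivAt (fun r : ℝ => 1 + (r : ℂ) * c / Complex.exp w) (c / Complex.exp w) r := by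
      have := ((Complex.ofRealCLM.hasDerivAt (x := r)).mul_const c).div_const (Complex.exp w)
      simpa using this.const_add 1
    convert! (h1.clog_real h0).const_add w using 1
    rw [hγexp r hr]
    have h2 := Complex.slitPlane_ne_zero h0
    have h3 : Complex.exp w + r * c = Complex.exp w * (1 + r * c / Complex.exp w) := by field_simp
    rw [h3, div_div]
  have hmain := energy_le (c := c) hc (ρ₀ := ‖Complex.exp w‖) (r₁ := r₁) (b := S / κ)
    (g := G * κ⁻¹ ^ (n + 1)) hx0 hr₁ (Nat.le_ceil _) hk hn
    (e := fun r => asymError μ Y (n + 1) (γ r))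
    (H := fun r i => -(c / Complex.exp (γ r)) * (μ i * asymError μ Y (n + 1) (γ r) i
        + (μ i - n) * formalCoeff μ n i * Complex.exp (-γ r) ^ n)) ?_ ?_
  · have e0 : γ 0 = w := by simp [γ]
    simpa only [e0] using hmain
  · intro r hr i
    have h1 := (hasDerivAt_asymError hμ hY n (γ r) i).comp r (hγ r hr)
    convert! h1 using 1
    have := Complex.exp_ne_zero (γ r)
    field_simp
    ring
  · intro r hr i
    have hρ : 0 < ‖Complex.exp w‖ + r := by linarith [hr.1]
    have h1 := (hpath r hr).1
    rw [← hγexp r hr] at h1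
    have h2 : ‖Complex.exp (γ r)‖⁻¹ ≤ κ⁻¹ * (‖Complex.exp w‖ + r)⁻¹ := by
      rw [← mul_inv]
      exact inv_anti₀ (by positivity) h1
    have h2' : ‖Complex.exp (-γ r)‖ ≤ κ⁻¹ * (‖Complex.exp w‖ + r)⁻¹ := by
      rwa [Complex.exp_neg, norm_inv]
    rw [norm_mul, norm_neg, norm_div, hc1, one_div]
    have h3 : ‖(μ i : ℂ) * asymError μ Y (n + 1) (γ r) i
        + (μ i - n) * formalCoeff μ n i * Complex.exp (-γ r) ^ n‖
        ≤ S * ‖asymError μ Y (n + 1) (γ r) i‖ + G * (κ⁻¹ * (‖Complex.exp w‖ + r)⁻¹) ^ n := by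
      refine (norm_add_le _ _).trans (add_le_add ?_ ?_)
      · rw [norm_mul, Complex.norm_real]
        exact mul_le_mul_of_nonneg_right (hS i) (norm_nonneg _)
      · rw [norm_mul, norm_pow]
        have := hG i
        gcongr
    refine (mul_le_mul h2 h3 (norm_nonneg _) (by positivity)).trans (le_of_eq ?_)
    rw [mul_pow, pow_succ]
    ring

/-- `Z ∼ e^{-ζ x} ∑_q ζ^i f_q (ζ x)^{-q}` to all orders, uniformly in the closed sector
`a ≤ arg x ≤ b`. For `ζ ^ 4 = 1` this is the formal solution of the model system that is obtained by
rotation from the one with `ζ = 1`. -/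
def IsAsymptotic (μ : Fin 4 → ℝ) (ζ : ℂ) (Z : ℂ → Fin 4 → ℂ) (a b : ℝ) : Prop :=
  ∀ n : ℕ, ∃ K R : ℝ, ∀ w : ℂ, R ≤ w.re → a ≤ w.im → w.im ≤ b → ∀ i : Fin 4,
    ‖Complex.exp (ζ * Complex.exp w) * Z w i
      - ∑ q ∈ Finset.range n, ζ ^ (i : ℕ) * formalCoeff μ q i * (ζ * Complex.exp w)⁻¹ ^ q‖
      ≤ K * Real.exp (-w.re) ^ n

theorem exists_norm_truncation_sub_le (μ : Fin 4 → ℝ) {n N : ℕ} (hnN : n ≤ N) :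
    ∃ K : ℝ, 0 ≤ K ∧ ∀ w : ℂ, 0 ≤ w.re → ∀ i,
      ‖truncation μ N w i - truncation μ n w i‖ ≤ K * Real.exp (-w.re) ^ n := by
  induction N, hnN using Nat.le_induction with
  | base => exact ⟨0, le_rfl, fun w _ i => by simp⟩
  | succ N hN ih =>
    obtain ⟨K, hK0, hK⟩ := ih
    refine ⟨K + ∑ i, ‖formalCoeff μ N i‖, by positivity, fun w hw i => ?_⟩
    have e : truncation μ (N + 1) w i = truncation μ N w i
        + formalCoeff μ N i * Complex.exp (-w) ^ N := Finset.sum_range_succ _ _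
    have h1 : ‖formalCoeff μ N i * Complex.exp (-w) ^ N‖
        ≤ (∑ i, ‖formalCoeff μ N i‖) * Real.exp (-w.re) ^ n := by
      rw [norm_mul, norm_pow, Complex.norm_exp, Complex.neg_re]
      refine mul_le_mul (Finset.single_le_sum (f := fun i => ‖formalCoeff μ N i‖)
        (fun i _ => norm_nonneg _) (Finset.mem_univ i)) ?_ (by positivity) (by positivity)
      exact pow_le_pow_of_le_one (Real.exp_pos _).le (Real.exp_le_one_iff.2 (by linarith)) hN
    rw [e, add_sub_right_comm]
    refine (norm_add_le _ _).trans ?_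
    rw [add_mul]
    exact add_le_add (hK w hw i) h1

theorem isAsymptotic_one_iff {μ : Fin 4 → ℝ} {Y : ℂ → Fin 4 → ℂ} {a b : ℝ} :
    IsAsymptotic μ 1 Y a b ↔ ∀ n : ℕ, ∃ K R : ℝ, ∀ w : ℂ, R ≤ w.re → a ≤ w.im → w.im ≤ b →
      ∀ i, ‖asymError μ Y n w i‖ ≤ K * Real.exp (-w.re) ^ n := by
  simp only [IsAsymptotic, asymError, truncation, one_pow, one_mul, Complex.exp_neg]

/-- It is enough to have asymptotic approximations of arbitrarily high order; they may even lose
one order. -/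
theorem isAsymptotic_one_of_frequently {μ : Fin 4 → ℝ} {Y : ℂ → Fin 4 → ℂ} {a b : ℝ}
    (h : ∀ n₀ : ℕ, ∃ n ≥ n₀, ∃ K R : ℝ, ∀ w : ℂ, R ≤ w.re → a ≤ w.im → w.im ≤ b →
      ∀ i, ‖asymError μ Y (n + 1) w i‖ ≤ K * Real.exp (-w.re) ^ n) :
    IsAsymptotic μ 1 Y a b := by
  rw [isAsymptotic_one_iff]
  intro n₀
  obtain ⟨n, hn, K, R, hK⟩ := h n₀
  obtain ⟨K', hK'0, hK'⟩ := exists_norm_truncation_sub_le μ (show n₀ ≤ n + 1 by omega)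
  refine ⟨|K| + K', max R 0, fun w hw ha hb i => ?_⟩
  have hw0 : 0 ≤ w.re := (le_max_right _ _).trans hw
  have e : asymError μ Y n₀ w i = asymError μ Y (n + 1) w i
      + (truncation μ (n + 1) w i - truncation μ n₀ w i) := by simp only [asymError]; ring
  rw [e, add_mul]
  refine (norm_add_le _ _).trans (add_le_add ?_ (hK' w hw0 i))
  refine (hK w ((le_max_left _ _).trans hw) ha hb i).trans ?_
  refine mul_le_mul (le_abs_self K) ?_ (by positivity) (abs_nonneg _)
  exact pow_le_pow_of_le_one (Real.exp_pos _).le (Real.exp_le_one_iff.2 (by linarith)) hn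

/-! ### The recessive solution and its asymptotics in the sector `|arg x| < 5π/4` -/

/-- The coefficient matrix of the model system. -/
def modelMatrix (μ : Fin 4 → ℝ) (w : ℂ) : Matrix (Fin 4) (Fin 4) ℂ :=
  Matrix.of fun i j => (if j = i + 1 then Complex.exp w else 0) - if j = i then (μ i : ℂ) else 0

theorem modelMatrix_mulVec (μ : Fin 4 → ℝ) (w : ℂ) (v : Fin 4 → ℂ) (i : Fin 4) :
    (modelMatrix μ w).mulVec v i = Complex.exp w * v (i + 1) - μ i * v i := by
  simp [modelMatrix, Matrix.mulVec, dotProduct, sub_mul, Finset.sum_sub_distrib]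

theorem exists_model_fundamental (μ : Fin 4 → ℝ) :
    ∃ W V : ℂ → Matrix (Fin 4) (Fin 4) ℂ,
      (∀ w i j, HasDerivAt (fun v => W v i j) ((modelMatrix μ w * W w) i j) w) ∧
      (∀ w i j, HasDerivAt (fun v => V v i j) ((-(V w * modelMatrix μ w)) i j) w) ∧
      (∀ w, V w * W w = 1) ∧ ∀ w, W w * V w = 1 := by
  refine exists_fundamental_matrix fun i j => ?_
  simp only [modelMatrix, Matrix.of_apply]
  split_ifs <;> fun_prop

theorem isModelSolution_mulVec {μ : Fin 4 → ℝ} {W : ℂ → Matrix (Fin 4) (Fin 4) ℂ}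
    (hW : ∀ w i j, HasDerivAt (fun v => W v i j) ((modelMatrix μ w * W w) i j) w)
    (u : Fin 4 → ℂ) : IsModelSolution μ fun w => (W w).mulVec u := by
  intro w i
  rw [← modelMatrix_mulVec, Matrix.mulVec_mulVec]
  simp only [Matrix.mulVec, dotProduct]
  exact HasDerivAt.fun_sum fun j _ => (hW w i j).mul_const (u j)

/-- An energy bound of order `k`, relative to the weight `X ^ (B + 1)`, is a bound of order `n` for
each component. -/
theorem norm_le_of_energy {B n k : ℕ} (hn : 2 * n = B + 1 + k) {X C : ℝ} (hX : 0 < X)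
    {e : Fin 4 → ℂ} (h : X ^ (B + 1) * ∑ i, ‖e i‖ ^ 2 ≤ C * X⁻¹ ^ k) (i : Fin 4) :
    ‖e i‖ ≤ Real.sqrt C * X⁻¹ ^ n := by
  have h1 : ‖e i‖ ^ 2 ≤ ∑ i, ‖e i‖ ^ 2 :=
    Finset.single_le_sum (f := fun i => ‖e i‖ ^ 2) (fun i _ => by positivity) (Finset.mem_univ i)
  have h2 : ‖e i‖ ^ 2 ≤ C * (X⁻¹ ^ n) ^ 2 := by
    have h3 : X ^ (B + 1) * ‖e i‖ ^ 2 ≤ C * X⁻¹ ^ k := (by gcongr : _ ≤ _).trans h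
    have h4 : C * (X⁻¹ ^ n) ^ 2 = X⁻¹ ^ (B + 1) * (C * X⁻¹ ^ k) := by
      rw [← pow_mul, mul_comm n 2, hn, pow_add]; ring
    rw [h4]
    calc ‖e i‖ ^ 2 = X⁻¹ ^ (B + 1) * (X ^ (B + 1) * ‖e i‖ ^ 2) := by
          rw [← mul_assoc, ← mul_pow, inv_mul_cancel₀ hX.ne', one_pow, one_mul]
      _ ≤ _ := by gcongr
  have hC : 0 ≤ C := by
    by_contra hC
    have : 0 < (X⁻¹ ^ n) ^ 2 := by positivity
    nlinarith [sq_nonneg ‖e i‖]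
  rw [← Real.sqrt_sq (norm_nonneg (e i)), ← Real.sqrt_sq (by positivity : 0 ≤ X⁻¹ ^ n),
    ← Real.sqrt_mul hC]
  exact Real.sqrt_le_sqrt h2

theorem real_segment (s r : ℝ) (hr : 0 ≤ r) :
    1 * (‖Complex.exp s‖ + r) ≤ ‖Complex.exp s + r * 1‖ ∧
      1 + r * 1 / Complex.exp s ∈ Complex.slitPlane := by
  have hs := Real.exp_pos s
  rw [← Complex.ofReal_exp]
  constructor
  · rw [mul_one, ← Complex.ofReal_add, Complex.norm_real, Complex.norm_real,
      Real.norm_of_nonneg hs.le, Real.norm_of_nonneg (by positivity), one_mul]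
  · left
    rw [mul_one, ← Complex.ofReal_div, ← Complex.ofReal_one, ← Complex.ofReal_add,
      Complex.ofReal_re]
    positivity

theorem real_segment_end (s r : ℝ) (hr : 0 ≤ r) :
    (s : ℂ) + Complex.log (1 + r * 1 / Complex.exp s) = (Real.log (Real.exp s + r) : ℝ) := by
  have hs := Real.exp_pos s
  rw [← Complex.ofReal_exp, mul_one, ← Complex.ofReal_div, ← Complex.ofReal_one,
    ← Complex.ofReal_add, ← Complex.ofReal_log (by positivity), ← Complex.ofReal_add]
  congr 1
  rw [show Real.exp s + r = Real.exp s * (1 + r / Real.exp s) by field_simp,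
    Real.log_mul hs.ne' (by positivity), Real.log_exp]

/-- A solution that is close to the truncated formal solution of one order on the positive real
axis. It is a limit of the solutions that agree with the truncated formal solution at the points
`x = N + 1`: by the energy estimate, their initial values at `x = 1` are bounded. -/
theorem exists_solution_near_truncation {μ : Fin 4 → ℝ} {B n k : ℕ} {C : ℝ}
    (hE : ∀ Y, IsModelSolution μ Y → ∀ (w c : ℂ) (r₁ : ℝ), ‖c‖ = 1 → |c.im| ≤ c.re → 0 ≤ r₁ →
        (∀ r ∈ Icc 0 r₁, 1 * (‖Complex.exp w‖ + r) ≤ ‖Complex.exp w + r * c‖ ∧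
          1 + r * c / Complex.exp w ∈ Complex.slitPlane) →
        ‖Complex.exp w‖ ^ (B + 1) * ∑ i, ‖asymError μ Y (n + 1) w i‖ ^ 2
          ≤ (‖Complex.exp w‖ + r₁) ^ (B + 1) *
              ∑ i, ‖asymError μ Y (n + 1) (w + Complex.log (1 + r₁ * c / Complex.exp w)) i‖ ^ 2
            + C * (‖Complex.exp w‖⁻¹) ^ k) :
    ∃ Y, IsModelSolution μ Y ∧ ∀ s : ℝ, 0 ≤ s →
      Real.exp s ^ (B + 1) * ∑ i, ‖asymError μ Y (n + 1) s i‖ ^ 2 ≤ C * (Real.exp s)⁻¹ ^ k := by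
  obtain ⟨W, V, hW, hV, hVW, hWV⟩ := exists_model_fundamental μ
  let x : ℕ → ℝ := fun N => N + 1
  have hx : ∀ N, 0 < x N := fun N => by positivity
  let p : ℕ → ℂ := fun N => (Real.log (x N) : ℝ)
  let u : ℕ → Fin 4 → ℂ := fun N =>
    (V (p N)).mulVec fun i => Complex.exp (-(x N)) * truncation μ (n + 1) (p N) i
  let Y : (Fin 4 → ℂ) → ℂ → Fin 4 → ℂ := fun u w => (W w).mulVec u
  have hY : ∀ u, IsModelSolution μ (Y u) := isModelSolution_mulVec hW
  have hexp : ∀ s : ℝ, ‖Complex.exp s‖ = Real.exp s := fun s => by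
    rw [Complex.norm_exp, Complex.ofReal_re]
  have hbound : ∀ N (s : ℝ), Real.exp s ≤ x N →
      Real.exp s ^ (B + 1) * ∑ i, ‖asymError μ (Y (u N)) (n + 1) s i‖ ^ 2
        ≤ C * (Real.exp s)⁻¹ ^ k := by
    intro N s hs
    have hr : 0 ≤ x N - Real.exp s := sub_nonneg.2 hs
    have h := hE (Y (u N)) (hY _) s 1 (x N - Real.exp s) (by simp) (by simp) hr
      (fun r hr => real_segment s r hr.1)
    rw [real_segment_end s _ hr, hexp] at h
    have hz : ∀ i, asymError μ (Y (u N)) (n + 1)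
        ((Real.log (Real.exp s + (x N - Real.exp s)) : ℝ) : ℂ) i = 0 := by
      intro i
      have e1 : Real.exp s + (x N - Real.exp s) = x N := by ring
      rw [e1]
      have e2 : Y (u N) (Real.log (x N) : ℝ) i
          = Complex.exp (-(x N)) * truncation μ (n + 1) (p N) i := by
        simp only [Y, u]
        rw [Matrix.mulVec_mulVec, hWV, Matrix.one_mulVec]
      have e3 : Complex.exp ((Real.log (x N) : ℝ) : ℂ) = x N := by
        rw [← Complex.ofReal_exp, Real.exp_log (hx N)]
      simp only [asymError]
      rw [e2, e3, ← mul_assoc, ← Complex.exp_add, add_neg_cancel, Complex.exp_zero, one_mul,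
        sub_self]
    simp only [hz] at h
    simpa using h
  have hcont : ∀ s : ℝ, Continuous fun u =>
      Real.exp s ^ (B + 1) * ∑ i, ‖asymError μ (Y u) (n + 1) s i‖ ^ 2 := by
    intro s
    simp only [asymError, Y, Matrix.mulVec, dotProduct]
    fun_prop
  have hbdd : Bornology.IsBounded (range u) := by
    have h1 : ∀ N i, ‖Y (u N) 0 i‖ ≤ Real.exp (-1) *
        (Real.sqrt C + ∑ i, ‖truncation μ (n + 1) 0 i‖) := by
      intro N i
      have h := hbound N 0 (by simp [x])
      simp only [Real.exp_zero, one_pow, one_mul, inv_one, mul_one, Complex.ofReal_zero] at h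
      have h2 : ‖asymError μ (Y (u N)) (n + 1) 0 i‖ ≤ Real.sqrt C := by
        refine Real.le_sqrt_of_sq_le (le_trans ?_ h)
        exact Finset.single_le_sum (f := fun i => ‖asymError μ (Y (u N)) (n + 1) 0 i‖ ^ 2)
          (fun i _ => by positivity) (Finset.mem_univ i)
      have h3 : ‖truncation μ (n + 1) 0 i‖ ≤ ∑ i, ‖truncation μ (n + 1) 0 i‖ :=
        Finset.single_le_sum (f := fun i => ‖truncation μ (n + 1) 0 i‖)
          (fun i _ => by positivity) (Finset.mem_univ i)
      have h4 : Y (u N) 0 i = Complex.exp (-1) *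
          (asymError μ (Y (u N)) (n + 1) 0 i + truncation μ (n + 1) 0 i) := by
        simp only [asymError, Complex.exp_zero, sub_add_cancel]
        rw [← mul_assoc, ← Complex.exp_add]
        simp
      rw [h4, norm_mul, Complex.norm_exp]
      simp only [Complex.neg_re, Complex.one_re]
      gcongr
      exact (norm_add_le _ _).trans (add_le_add h2 h3)
    have h2 : ∀ N, u N = (V 0).mulVec (Y (u N) 0) := by
      intro N
      simp only [Y]
      rw [Matrix.mulVec_mulVec, hVW, Matrix.one_mulVec]
    obtain ⟨M, hM⟩ : ∃ M, ∀ N i, ‖Y (u N) 0 i‖ ≤ M := ⟨_, h1⟩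
    refine isBounded_iff_forall_norm_le.2 ⟨∑ i, ∑ j, ‖V 0 i j‖ * M, ?_⟩
    rintro _ ⟨N, rfl⟩
    have hM0 : 0 ≤ M := (norm_nonneg _).trans (hM 0 0)
    refine (pi_norm_le_iff_of_nonneg (by positivity)).2 fun i => ?_
    rw [h2 N]
    simp only [Matrix.mulVec, dotProduct]
    calc ‖∑ j, V 0 i j * Y (u N) 0 j‖ ≤ ∑ j, ‖V 0 i j‖ * M := by
          refine norm_sum_le_of_le _ fun j _ => ?_
          rw [norm_mul]
          exact mul_le_mul_of_nonneg_left (hM N j) (norm_nonneg _)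
      _ ≤ _ := Finset.single_le_sum (f := fun i => ∑ j, ‖V 0 i j‖ * M)
          (fun i _ => by positivity) (Finset.mem_univ i)
  obtain ⟨v, _, φ, hφ, hv⟩ := tendsto_subseq_of_bounded hbdd (fun N => mem_range_self N)
  refine ⟨Y v, hY v, fun s hs => ?_⟩
  refine le_of_tendsto (((hcont s).tendsto v).comp hv) ?_
  filter_upwards [(tendsto_natCast_atTop_atTop (R := ℝ)).eventually_ge_atTop (Real.exp s)] with N hN
  refine hbound (φ N) s (hN.trans ?_)
  have : (N : ℝ) ≤ φ N := by exact_mod_cast hφ.id_le N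
  simp only [x]
  linarith

/-- The solution close to the truncated formal solution of order `B + 1` is asymptotic to the formal
solution to all orders: in the energy estimate of any higher order, the term from the far end of the
segment vanishes in the limit. -/
theorem exists_recessive_solution_ray {μ : Fin 4 → ℝ} (hμ : ∑ i, μ i = 0) :
    ∃ Y, IsModelSolution μ Y ∧ IsAsymptotic μ 1 Y 0 0 := by
  obtain ⟨B, hB⟩ := exists_energy_bound hμ one_pos
  obtain ⟨C, hC0, hC⟩ := hB (B + 1) (B + 1) (by omega) (by omega)
  obtain ⟨Y, hY, hYC⟩ := exists_solution_near_truncation hC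
  refine ⟨Y, hY, isAsymptotic_one_of_frequently fun n₀ => ?_⟩
  let n := max (B + 1) n₀
  have hnB : B + 1 ≤ n := le_max_left _ _
  obtain ⟨k, hk⟩ : ∃ k, 2 * n = B + 1 + k := ⟨2 * n - (B + 1), by omega⟩
  obtain ⟨C', hC'0, hC'⟩ := hB n k (by omega) hk
  obtain ⟨K, hK0, hK⟩ := exists_norm_truncation_sub_le μ (show B + 1 + 1 ≤ n + 1 by omega)
  refine ⟨n, le_max_right _ _, Real.sqrt C', 0, fun w hw ha hb i => ?_⟩
  obtain ⟨s, rfl⟩ : ∃ s : ℝ, w = s := ⟨w.re, Complex.ext (by simp) (by simp; linarith)⟩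
  rw [Complex.ofReal_re] at hw ⊢
  have hexp : ∀ s : ℝ, ‖Complex.exp s‖ = Real.exp s := fun s => by
    rw [Complex.norm_exp, Complex.ofReal_re]
  rw [Real.exp_neg]
  refine norm_le_of_energy hk (Real.exp_pos s) ?_ i
  -- the energy at the end `X` of the segment is `O(1 / X)`, by the estimate of order `B + 1`
  have hfar : ∀ X : ℝ, 1 ≤ X →
      X ^ (B + 1) * ∑ i, ‖asymError μ Y (n + 1) (Real.log X : ℝ) i‖ ^ 2
        ≤ (2 * C + 8 * K ^ 2) * X⁻¹ := by
    intro X hX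
    have hX0 : 0 < X := by linarith
    have hlog : 0 ≤ Real.log X := Real.log_nonneg hX
    have h1 := hYC (Real.log X) hlog
    rw [Real.exp_log hX0] at h1
    have hX1 : X⁻¹ ≤ 1 := inv_le_one_of_one_le₀ hX
    have hterm : ∀ i, ‖asymError μ Y (n + 1) (Real.log X : ℝ) i‖ ^ 2
        ≤ 2 * ‖asymError μ Y (B + 1 + 1) (Real.log X : ℝ) i‖ ^ 2
          + 2 * (K * X⁻¹ ^ (B + 1 + 1)) ^ 2 := by
      intro i
      have e : asymError μ Y (n + 1) (Real.log X : ℝ) i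
          = asymError μ Y (B + 1 + 1) (Real.log X : ℝ) i
            - (truncation μ (n + 1) (Real.log X : ℝ) i
              - truncation μ (B + 1 + 1) (Real.log X : ℝ) i) := by
        simp only [asymError]; ring
      have h2 := hK (Real.log X : ℝ) (by simpa using hlog) i
      rw [Complex.ofReal_re, Real.exp_neg, Real.exp_log hX0] at h2
      have h3 := (norm_sub_le (asymError μ Y (B + 1 + 1) (Real.log X : ℝ) i)
        (truncation μ (n + 1) (Real.log X : ℝ) i
              - truncation μ (B + 1 + 1) (Real.log X : ℝ) i)).trans (add_le_add le_rfl h2)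
      rw [e]
      refine (pow_le_pow_left₀ (norm_nonneg _) h3 2).trans ?_
      nlinarith [sq_nonneg (‖asymError μ Y (B + 1 + 1) (Real.log X : ℝ) i‖
        - K * X⁻¹ ^ (B + 1 + 1))]
    have hsum := Finset.sum_le_sum fun i (_ : i ∈ Finset.univ) => hterm i
    rw [Finset.sum_add_distrib, ← Finset.mul_sum] at hsum
    simp only [Finset.sum_const, Finset.card_univ, Fintype.card_fin, nsmul_eq_mul] at hsum
    have p1 : X⁻¹ ^ (B + 1) ≤ X⁻¹ := by
      simpa using pow_le_pow_of_le_one (inv_pos.2 hX0).le hX1 (show 1 ≤ B + 1 by omega)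
    have p2 : X ^ (B + 1) * (X⁻¹ ^ (B + 1 + 1)) ^ 2 ≤ X⁻¹ := by
      have : X ^ (B + 1) * (X⁻¹ ^ (B + 1 + 1)) ^ 2 = X⁻¹ ^ (B + 3) := by
        rw [← pow_mul, show (B + 1 + 1) * 2 = B + 1 + (B + 3) by ring, pow_add X⁻¹, ← mul_assoc,
          ← mul_pow, mul_inv_cancel₀ hX0.ne', one_pow, one_mul]
      rw [this]
      simpa using pow_le_pow_of_le_one (inv_pos.2 hX0).le hX1 (show 1 ≤ B + 3 by omega)
    have p3 := mul_le_mul_of_nonneg_left hsum (pow_pos hX0 (B + 1)).le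
    have p4 := mul_le_mul_of_nonneg_left p1 hC0
    have p5 := mul_le_mul_of_nonneg_left p2 (sq_nonneg K)
    push_cast at p3
    nlinarith
  have hlim : Tendsto (fun X : ℝ => (2 * C + 8 * K ^ 2) * X⁻¹ + C' * (Real.exp s)⁻¹ ^ k) atTop
      (𝓝 (C' * (Real.exp s)⁻¹ ^ k)) := by
    simpa using (tendsto_inv_atTop_zero.const_mul (2 * C + 8 * K ^ 2)).add_const
      (C' * (Real.exp s)⁻¹ ^ k)
  refine ge_of_tendsto hlim ?_
  filter_upwards [eventually_ge_atTop (Real.exp s), eventually_ge_atTop 1] with X hX hX1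
  have hr : 0 ≤ X - Real.exp s := sub_nonneg.2 hX
  have h := hC' Y hY s 1 (X - Real.exp s) (by simp) (by simp) hr
    (fun r hr => real_segment s r hr.1)
  rw [real_segment_end s _ hr, hexp, add_sub_cancel] at h
  linarith [hfar X hX1]

theorem IsAsymptotic.mono {μ : Fin 4 → ℝ} {ζ : ℂ} {Z : ℂ → Fin 4 → ℂ} {a b a' b' : ℝ}
    (h : IsAsymptotic μ ζ Z a b) (ha : a ≤ a') (hb : b' ≤ b) : IsAsymptotic μ ζ Z a' b' := by
  intro n
  obtain ⟨K, R, hK⟩ := h n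
  exact ⟨K, R, fun w hw h1 h2 => hK w hw (ha.trans h1) (h2.trans hb)⟩

theorem IsAsymptotic.union {μ : Fin 4 → ℝ} {ζ : ℂ} {Z : ℂ → Fin 4 → ℂ} {a b c : ℝ}
    (h₁ : IsAsymptotic μ ζ Z a c) (h₂ : IsAsymptotic μ ζ Z c b) : IsAsymptotic μ ζ Z a b := by
  intro n
  obtain ⟨K, R, hK⟩ := h₁ n
  obtain ⟨K', R', hK'⟩ := h₂ n
  refine ⟨max K K', max R R', fun w hw ha hb i => ?_⟩
  rcases le_total w.im c with hc | hc
  · exact (hK w ((le_max_left _ _).trans hw) ha hc i).trans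
      (mul_le_mul_of_nonneg_right (le_max_left _ _) (by positivity))
  · exact (hK' w ((le_max_right _ _).trans hw) hc hb i).trans
      (mul_le_mul_of_nonneg_right (le_max_right _ _) (by positivity))

theorem norm_one_add_mul_exp_ge {κ τ θ : ℝ} (h : 2 * κ ^ 2 ≤ 1 + Real.cos θ) :
    κ * (1 + τ) ≤ ‖1 + τ * Complex.exp (θ * Complex.I)‖ := by
  have hsq : ‖1 + τ * Complex.exp (θ * Complex.I)‖ ^ 2 = 1 + 2 * τ * Real.cos θ + τ ^ 2 := by
    rw [← Complex.normSq_eq_norm_sq, Complex.normSq_apply]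
    simp only [Complex.add_re, Complex.add_im, Complex.one_re, Complex.one_im, Complex.mul_re,
      Complex.mul_im, Complex.ofReal_re, Complex.ofReal_im, Complex.exp_ofReal_mul_I_re,
      Complex.exp_ofReal_mul_I_im]
    nlinarith [Real.sin_sq_add_cos_sq θ]
  refine le_of_sq_le_sq ?_ (norm_nonneg _)
  rw [hsq]
  nlinarith [mul_nonneg (sq_nonneg (1 - τ)) (sub_nonneg.2 (Real.cos_le_one θ)),
    mul_le_mul_of_nonneg_left h (sq_nonneg (1 + τ))]

theorem one_add_mul_exp_mem_slitPlane {τ θ : ℝ} (hτ : 0 ≤ τ) (h : |θ| < Real.pi) :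
    1 + τ * Complex.exp (θ * Complex.I) ∈ Complex.slitPlane := by
  rw [Complex.mem_slitPlane_iff]
  simp only [Complex.add_re, Complex.add_im, Complex.one_re, Complex.one_im, Complex.mul_re,
      Complex.mul_im, Complex.ofReal_re, Complex.ofReal_im, Complex.exp_ofReal_mul_I_re,
      Complex.exp_ofReal_mul_I_im, zero_mul, sub_zero, add_zero, zero_add]
  by_contra! hc
  rcases mul_eq_zero.1 hc.2 with h0 | h0
  · rw [h0] at hc; linarith [hc.1]
  · have hθ : θ = 0 := by
      rw [abs_lt] at h
      exact (Real.sin_eq_zero_iff_of_lt_of_lt h.1 h.2).1 h0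
    rw [hθ, Real.cos_zero] at hc
    linarith [hc.1]

/-- The law of sines in the triangle with vertices `0`, `x` and the point where the line through `x`
in direction `e^{iφ}` meets the ray `arg = ψ₀`. -/
theorem one_add_sin_mul_exp {α φ ψ₀ : ℝ} (h : Real.sin (ψ₀ - φ) ≠ 0) :
    1 + (Real.sin (α - ψ₀) / Real.sin (ψ₀ - φ) : ℝ) * Complex.exp ((φ - α : ℝ) * Complex.I)
      = (Real.sin (α - φ) / Real.sin (ψ₀ - φ) : ℝ) * Complex.exp ((ψ₀ - α : ℝ) * Complex.I) := by
  have e1 := Real.sin_sub ψ₀ φ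
  have e2 := Real.sin_sub α ψ₀
  have e3 := Real.sin_sub α φ
  have e4 := Real.cos_sub φ α
  have e5 := Real.sin_sub φ α
  have e6 := Real.cos_sub ψ₀ α
  have e7 := Real.sin_sub ψ₀ α
  have s1 := Real.sin_sq_add_cos_sq α
  have s2 := Real.sin_sq_add_cos_sq ψ₀
  apply Complex.ext
  · simp only [Complex.add_re, Complex.one_re, Complex.mul_re, Complex.ofReal_re,
      Complex.ofReal_im, Complex.exp_ofReal_mul_I_re, zero_mul, sub_zero]
    field_simp
    rw [e1, e2, e3, e4, e6]
    linear_combination (Real.sin φ * Real.cos ψ₀ - Real.sin ψ₀ * Real.cos φ) * s1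
  · simp only [Complex.add_im, Complex.one_im, Complex.mul_im, Complex.ofReal_re,
      Complex.ofReal_im, Complex.exp_ofReal_mul_I_im, zero_mul, add_zero, zero_add]
    field_simp
    rw [e2, e3, e5, e7]
    ring

/-- Asymptotics on the ray `arg x = ψ₀` extend to a sector from which the ray can be reached along
segments of direction `e^{iφ}`, `|φ| ≤ π/4`, that stay away from the origin. -/
theorem IsAsymptotic.propagate {μ : Fin 4 → ℝ} (hμ : ∑ i, μ i = 0) {Y : ℂ → Fin 4 → ℂ}
    (hY : IsModelSolution μ Y) {φ ψ₀ δ a b : ℝ} (hφ : |φ| ≤ Real.pi / 4) (hδ : 0 < δ)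
    (hδπ : δ ≤ Real.pi)
    (h0 : IsAsymptotic μ 1 Y ψ₀ ψ₀)
    (h1 : ∀ α, a ≤ α → α ≤ b → |φ - α| ≤ Real.pi - δ)
    (h2 : ∀ α, a ≤ α → α ≤ b → |ψ₀ - α| < Real.pi)
    (h3 : ∀ α, a ≤ α → α ≤ b → 0 ≤ Real.sin (α - ψ₀) / Real.sin (ψ₀ - φ))
    (h4 : ∀ α, a ≤ α → α ≤ b → 0 < Real.sin (α - φ) / Real.sin (ψ₀ - φ)) :
    IsAsymptotic μ 1 Y a b := by
  rcases lt_or_ge b a with hab | hab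
  · exact fun n => ⟨0, 0, fun w _ ha hb => absurd (ha.trans hb) (not_le.2 hab)⟩
  have hsin : Real.sin (ψ₀ - φ) ≠ 0 := by
    intro h
    have := h4 a le_rfl hab
    rw [h, div_zero] at this
    exact lt_irrefl _ this
  let κ := Real.sin (δ / 2)
  have hκ : 0 < κ := Real.sin_pos_of_pos_of_lt_pi (by linarith) (by linarith)
  have hκ1 : κ ≤ 1 := Real.sin_le_one _
  have hκcos : ∀ α, a ≤ α → α ≤ b → 2 * κ ^ 2 ≤ 1 + Real.cos (φ - α) := by
    intro α ha hb
    have e : 2 * κ ^ 2 = 1 + Real.cos (Real.pi - δ) := by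
      have h5 := Real.cos_two_mul (δ / 2)
      rw [mul_div_cancel₀ _ (two_ne_zero)] at h5
      have h6 := Real.sin_sq_add_cos_sq (δ / 2)
      rw [Real.cos_pi_sub, h5]
      simp only [κ]
      linarith
    rw [e, ← Real.cos_abs (φ - α)]
    have := Real.cos_le_cos_of_nonneg_of_le_pi (abs_nonneg _) (by linarith) (h1 α ha hb)
    linarith
  let T := 1 / |Real.sin (ψ₀ - φ)|
  have hT : ∀ α, Real.sin (α - ψ₀) / Real.sin (ψ₀ - φ) ≤ T := by
    intro α
    refine (le_abs_self _).trans ?_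
    rw [abs_div]
    exact div_le_div_of_nonneg_right (Real.abs_sin_le_one _) (abs_nonneg _)
  have hT0 : 0 ≤ T := by positivity
  obtain ⟨B, hB⟩ := exists_energy_bound hμ hκ
  refine isAsymptotic_one_of_frequently fun n₀ => ?_
  let n := max (B + 1) n₀
  have hnB : B + 1 ≤ n := le_max_left _ _
  obtain ⟨k, hk⟩ : ∃ k, 2 * n = B + 1 + k := ⟨2 * n - (B + 1), by omega⟩
  obtain ⟨C, hC0, hC⟩ := hB n k (by omega) hk
  obtain ⟨K, R, hK⟩ := isAsymptotic_one_iff.1 h0 (n + 1)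
  refine ⟨n, le_max_right _ _,
    Real.sqrt ((1 + T) ^ (B + 1) * (4 * (|K| * κ⁻¹ ^ (n + 1)) ^ 2) + C),
    max 0 (R - Real.log κ), fun w hw ha hb i => ?_⟩
  have hw0 : 0 ≤ w.re := (le_max_left _ _).trans hw
  have hwR : R - Real.log κ ≤ w.re := (le_max_right _ _).trans hw
  have hX : ‖Complex.exp w‖ = Real.exp w.re := Complex.norm_exp w
  have hX0 := Real.exp_pos w.re
  have hX1 : 1 ≤ Real.exp w.re := Real.one_le_exp hw0
  -- the segment from `x` has length `|x| τ` and ends at modulus `|x| σ`, by the law of sines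
  let α := w.im
  let τ := Real.sin (α - ψ₀) / Real.sin (ψ₀ - φ)
  let σ := Real.sin (α - φ) / Real.sin (ψ₀ - φ)
  have hτ0 : 0 ≤ τ := h3 α ha hb
  have hσ0 : 0 < σ := h4 α ha hb
  have hquot : ∀ r : ℝ, r * Complex.exp (φ * Complex.I) / Complex.exp w
      = (r / Real.exp w.re : ℝ) * Complex.exp ((φ - α : ℝ) * Complex.I) := by
    intro r
    rw [mul_div_assoc, ← Complex.exp_sub, Complex.ofReal_div, Complex.ofReal_exp, div_mul_eq_mul_div,
      mul_div_assoc, ← Complex.exp_sub]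
    congr 2
    apply Complex.ext <;> simp [α]
  have hκσ : κ ≤ σ := by
    have h5 := norm_one_add_mul_exp_ge (τ := τ) (hκcos α ha hb)
    rw [one_add_sin_mul_exp hsin, norm_mul, Complex.norm_exp_ofReal_mul_I, mul_one,
      Complex.norm_real, Real.norm_of_nonneg hσ0.le] at h5
    nlinarith
  have hpath : ∀ r ∈ Icc 0 (Real.exp w.re * τ),
      κ * (‖Complex.exp w‖ + r) ≤ ‖Complex.exp w + r * Complex.exp (φ * Complex.I)‖ ∧
        1 + r * Complex.exp (φ * Complex.I) / Complex.exp w ∈ Complex.slitPlane := by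
    intro r hr
    have hr0 : 0 ≤ r / Real.exp w.re := div_nonneg hr.1 hX0.le
    rw [hquot]
    constructor
    · have h5 := norm_one_add_mul_exp_ge (τ := r / Real.exp w.re) (hκcos α ha hb)
      rw [← hquot] at h5
      have h6 : Complex.exp w + r * Complex.exp (φ * Complex.I)
          = Complex.exp w * (1 + r * Complex.exp (φ * Complex.I) / Complex.exp w) := by
        field_simp [Complex.exp_ne_zero w]
      rw [h6, norm_mul, hX]
      calc κ * (Real.exp w.re + r) = Real.exp w.re * (κ * (1 + r / Real.exp w.re)) := by
            field_simp
        _ ≤ _ := by gcongr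
    · refine one_add_mul_exp_mem_slitPlane hr0 ((h1 α ha hb).trans_lt (by linarith))
  have hc : |(Complex.exp (φ * Complex.I)).im| ≤ (Complex.exp (φ * Complex.I)).re := by
    rw [Complex.exp_ofReal_mul_I_re, Complex.exp_ofReal_mul_I_im]
    have hp := Real.pi_pos
    rw [abs_le] at hφ
    have h5 : Real.sin (Real.pi / 4 + φ) = Real.sqrt 2 / 2 * (Real.cos φ + Real.sin φ) := by
      rw [Real.sin_add, Real.sin_pi_div_four, Real.cos_pi_div_four]; ring
    have h6 : Real.sin (Real.pi / 4 - φ) = Real.sqrt 2 / 2 * (Real.cos φ - Real.sin φ) := by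
      rw [Real.sin_sub, Real.sin_pi_div_four, Real.cos_pi_div_four]; ring
    have h7 : 0 ≤ Real.sin (Real.pi / 4 + φ) :=
      Real.sin_nonneg_of_nonneg_of_le_pi (by linarith) (by linarith)
    have h8 : 0 ≤ Real.sin (Real.pi / 4 - φ) :=
      Real.sin_nonneg_of_nonneg_of_le_pi (by linarith) (by linarith)
    rw [h5] at h7
    rw [h6] at h8
    have h9 : 0 < Real.sqrt 2 / 2 := by positivity
    have := nonneg_of_mul_nonneg_right h7 h9
    have := nonneg_of_mul_nonneg_right h8 h9
    rw [abs_le]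
    constructor <;> linarith
  have hmain := hC Y hY w (Complex.exp (φ * Complex.I)) (Real.exp w.re * τ)
    (Complex.norm_exp_ofReal_mul_I φ) hc (mul_nonneg hX0.le hτ0) hpath
  have hend : Complex.log (1 + (Real.exp w.re * τ : ℝ) * Complex.exp (φ * Complex.I) / Complex.exp w)
      = (Real.log σ : ℝ) + (ψ₀ - α : ℝ) * Complex.I := by
    rw [hquot, mul_div_cancel_left₀ _ hX0.ne', one_add_sin_mul_exp hsin,
      Complex.log_ofReal_mul hσ0 (Complex.exp_ne_zero _)]
    have h5 := abs_lt.1 (h2 α ha hb)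
    rw [Complex.log_exp] <;> simp <;> linarith
  rw [hend, hX] at hmain
  set w₁ := w + ((Real.log σ : ℝ) + (ψ₀ - α : ℝ) * Complex.I) with hw₁
  have hre : w₁.re = w.re + Real.log σ := by simp [hw₁]
  have him : w₁.im = ψ₀ := by simp [hw₁, α]
  have hlog : Real.log κ ≤ Real.log σ := Real.log_le_log hκ hκσ
  have hendle : ∀ i, ‖asymError μ Y (n + 1) w₁ i‖ ^ 2
      ≤ (|K| * κ⁻¹ ^ (n + 1)) ^ 2 * ((Real.exp w.re)⁻¹ ^ (n + 1)) ^ 2 := by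
    intro i
    have h5 := hK w₁ (by rw [hre]; linarith) him.ge him.le i
    rw [← mul_pow]
    refine pow_le_pow_left₀ (norm_nonneg _) (h5.trans ?_) 2
    rw [mul_assoc, ← mul_pow]
    have h6 : Real.exp (-w₁.re) ≤ κ⁻¹ * (Real.exp w.re)⁻¹ := by
      rw [hre, Real.exp_neg, Real.exp_add, Real.exp_log hσ0, mul_comm, mul_inv]
      gcongr
    gcongr
    exact le_abs_self K
  rw [Real.exp_neg]
  refine norm_le_of_energy hk hX0 (hmain.trans ?_) i
  rw [add_mul]
  refine add_le_add ?_ le_rfl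
  have h7 := Finset.sum_le_sum fun i (_ : i ∈ Finset.univ) => hendle i
  simp only [Finset.sum_const, Finset.card_univ, Fintype.card_fin, nsmul_eq_mul] at h7
  have h8 : Real.exp w.re + Real.exp w.re * τ ≤ Real.exp w.re * (1 + T) := by
    nlinarith [hT α]
  have h9 : Real.exp w.re ^ (B + 1) * ((Real.exp w.re)⁻¹ ^ (n + 1)) ^ 2
      ≤ (Real.exp w.re)⁻¹ ^ k := by
    have : Real.exp w.re ^ (B + 1) * ((Real.exp w.re)⁻¹ ^ (n + 1)) ^ 2
        = (Real.exp w.re)⁻¹ ^ (k + 2) := by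
      rw [← pow_mul, show (n + 1) * 2 = B + 1 + (k + 2) by omega, pow_add (Real.exp w.re)⁻¹,
        ← mul_assoc, ← mul_pow, mul_inv_cancel₀ hX0.ne', one_pow, one_mul]
    rw [this]
    exact pow_le_pow_of_le_one (inv_pos.2 hX0).le (inv_le_one_of_one_le₀ hX1) (by omega)
  calc (Real.exp w.re + Real.exp w.re * τ) ^ (B + 1) * ∑ i, ‖asymError μ Y (n + 1) w₁ i‖ ^ 2
      ≤ (Real.exp w.re * (1 + T)) ^ (B + 1) *
        ((4 : ℕ) * ((|K| * κ⁻¹ ^ (n + 1)) ^ 2 * ((Real.exp w.re)⁻¹ ^ (n + 1)) ^ 2)) := by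
        gcongr
    _ = (1 + T) ^ (B + 1) * (4 * (|K| * κ⁻¹ ^ (n + 1)) ^ 2) *
        (Real.exp w.re ^ (B + 1) * ((Real.exp w.re)⁻¹ ^ (n + 1)) ^ 2) := by
        rw [mul_pow]; push_cast; ring
    _ ≤ _ := by gcongr

theorem IsAsymptotic.propagate_right {μ : Fin 4 → ℝ} (hμ : ∑ i, μ i = 0) {Y : ℂ → Fin 4 → ℂ}
    (hY : IsModelSolution μ Y) {φ ψ₀ b : ℝ} (hφ : |φ| ≤ Real.pi / 4) (hφψ : φ < ψ₀)
    (hb : b < φ + Real.pi) (h0 : IsAsymptotic μ 1 Y ψ₀ ψ₀) : IsAsymptotic μ 1 Y ψ₀ b := by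
  rcases lt_or_ge b ψ₀ with hbψ | hbψ
  · exact fun n => ⟨0, 0, fun w _ h1 h2 => absurd (h1.trans h2) (not_le.2 hbψ)⟩
  have hs : 0 < Real.sin (ψ₀ - φ) :=
    Real.sin_pos_of_pos_of_lt_pi (by linarith) (by linarith)
  refine h0.propagate hμ hY (δ := φ + Real.pi - b) hφ (by linarith) (by linarith)
    (fun α h1 h2 => ?_) (fun α h1 h2 => ?_) (fun α h1 h2 => ?_) (fun α h1 h2 => ?_)
  · rw [abs_le]; constructor <;> linarith
  · rw [abs_lt]; constructor <;> linarith
  · exact div_nonneg (Real.sin_nonneg_of_nonneg_of_le_pi (by linarith) (by linarith)) hs.le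
  · exact div_pos (Real.sin_pos_of_pos_of_lt_pi (by linarith) (by linarith)) hs

theorem IsAsymptotic.propagate_left {μ : Fin 4 → ℝ} (hμ : ∑ i, μ i = 0) {Y : ℂ → Fin 4 → ℂ}
    (hY : IsModelSolution μ Y) {φ ψ₀ a : ℝ} (hφ : |φ| ≤ Real.pi / 4) (hφψ : ψ₀ < φ)
    (ha : φ - Real.pi < a) (h0 : IsAsymptotic μ 1 Y ψ₀ ψ₀) : IsAsymptotic μ 1 Y a ψ₀ := by
  rcases lt_or_ge ψ₀ a with haψ | haψ
  · exact fun n => ⟨0, 0, fun w _ h1 h2 => absurd (h1.trans h2) (not_le.2 haψ)⟩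
  have hs : Real.sin (ψ₀ - φ) < 0 :=
    Real.sin_neg_of_neg_of_neg_pi_lt (by linarith) (by linarith)
  refine h0.propagate hμ hY (δ := a - (φ - Real.pi)) hφ (by linarith) (by linarith)
    (fun α h1 h2 => ?_) (fun α h1 h2 => ?_) (fun α h1 h2 => ?_) (fun α h1 h2 => ?_)
  · rw [abs_le]; constructor <;> linarith
  · rw [abs_lt]; constructor <;> linarith
  · exact div_nonneg_of_nonpos
      (Real.sin_nonpos_of_nonpos_of_neg_pi_le (by linarith) (by linarith)) hs.le
  · exact div_pos_of_neg_of_neg (Real.sin_neg_of_neg_of_neg_pi_lt (by linarith) (by linarith)) hs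

/-- The model system has a solution that is asymptotic to the formal solution with the exponential
factor `e^{-x}` in the sector `|arg x| < 5π/4`. -/
theorem exists_recessive_solution {μ : Fin 4 → ℝ} (hμ : ∑ i, μ i = 0) :
    ∃ Y, IsModelSolution μ Y ∧ ∀ a b, -(5 * Real.pi / 4) < a → b < 5 * Real.pi / 4 →
      IsAsymptotic μ 1 Y a b := by
  obtain ⟨Y, hY, h0⟩ := exists_recessive_solution_ray hμ
  refine ⟨Y, hY, fun a b ha hb => ?_⟩
  have hp := Real.pi_pos
  have hq : |Real.pi / 4| ≤ Real.pi / 4 := (abs_of_pos (by linarith)).le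
  have hq' : |-(Real.pi / 4)| ≤ Real.pi / 4 := by rwa [abs_neg]
  have r1 : IsAsymptotic μ 1 Y 0 (Real.pi / 2) :=
    h0.propagate_right hμ hY hq' (by linarith) (by linarith)
  have r2 : IsAsymptotic μ 1 Y (Real.pi / 2) b :=
    (r1.mono (by linarith) le_rfl).propagate_right hμ hY hq (by linarith) (by linarith)
  have l1 : IsAsymptotic μ 1 Y (-(Real.pi / 2)) 0 :=
    h0.propagate_left hμ hY hq (by linarith) (by linarith)
  have l2 : IsAsymptotic μ 1 Y a (-(Real.pi / 2)) :=
    (l1.mono le_rfl (by linarith)).propagate_left hμ hY hq' (by linarith) (by linarith)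
  exact l2.union (l1.union (r1.union r2))

/-! ### Monodromy of the model system -/

/-- The rotation of a vector function by `k` quarter turns `x ↦ i^k x`. Multiplication of the `j`-th
component by `(i^k)^j` makes it an action of `ℤ` on the solutions of the model system. -/
def rotate (k : ℤ) (Y : ℂ → Fin 4 → ℂ) : ℂ → Fin 4 → ℂ := fun w i =>
  (Complex.I ^ k) ^ (i : ℕ) * Y (w + k * (Real.pi / 2) * Complex.I) i

theorem exp_quarter_turns (k : ℤ) : Complex.exp (k * (Real.pi / 2) * Complex.I) = Complex.I ^ k := by
  rw [mul_assoc, Complex.exp_int_mul, Complex.exp_pi_div_two_mul_I]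

theorem I_zpow_pow_four (k : ℤ) : (Complex.I ^ k) ^ 4 = 1 := by
  rw [← zpow_natCast, ← zpow_mul, mul_comm, zpow_mul]
  norm_num

theorem I_zpow_ne_zero (k : ℤ) : Complex.I ^ k ≠ 0 := zpow_ne_zero _ Complex.I_ne_zero

theorem pow_fin_succ {ζ : ℂ} (hζ : ζ ^ 4 = 1) (i : Fin 4) :
    ζ ^ ((i + 1 : Fin 4) : ℕ) = ζ * ζ ^ (i : ℕ) := by
  fin_cases i
  · simp
  · simp [pow_two]
  · show ζ ^ 3 = ζ * ζ ^ 2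
    ring
  · show ζ ^ 0 = ζ * ζ ^ 3
    rw [pow_zero, ← hζ]
    ring

theorem rotate_rotate (j k : ℤ) (Y : ℂ → Fin 4 → ℂ) : rotate j (rotate k Y) = rotate (j + k) Y := by
  funext w i
  simp only [rotate]
  have h : w + j * (Real.pi / 2) * Complex.I + k * (Real.pi / 2) * Complex.I
      = w + ((j + k : ℤ) : ℂ) * (Real.pi / 2) * Complex.I := by
    push_cast
    ring
  rw [h, zpow_add₀ Complex.I_ne_zero, mul_pow]
  ring

theorem IsModelSolution.rotate {μ : Fin 4 → ℝ} {Y : ℂ → Fin 4 → ℂ} (hY : IsModelSolution μ Y)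
    (k : ℤ) : IsModelSolution μ (rotate k Y) := by
  intro w i
  have h1 : HasDerivAt (fun v : ℂ => v + k * (Real.pi / 2) * Complex.I) 1 w :=
    (hasDerivAt_id w).add_const _
  convert! ((hY (w + k * (Real.pi / 2) * Complex.I) i).comp w h1).const_mul
    ((Complex.I ^ k) ^ (i : ℕ)) using 1
  simp only [TTStarToda.rotate]
  rw [Complex.exp_add, exp_quarter_turns, pow_fin_succ (I_zpow_pow_four k)]
  ring

/-- The eigenvalues of `rotate 1` on the space of solutions of the model system. -/
def monodromyEigenvalue (μ : Fin 4 → ℝ) (i : Fin 4) : ℂ :=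
  Complex.I ^ (i : ℕ) * Complex.exp (-(μ i * (Real.pi / 2) * Complex.I))

/-- The transition matrix from `w` to `w + π i / 2` tends, as `Re w → -∞`, to the one of the system
with constant coefficients `Y_i' = -μ_i Y_i`. -/
theorem tendsto_transition {μ : Fin 4 → ℝ} {W V : ℂ → Matrix (Fin 4) (Fin 4) ℂ}
    (hW : ∀ w i j, HasDerivAt (fun v => W v i j) ((modelMatrix μ w * W w) i j) w)
    (hWV : ∀ w, W w * V w = 1) (i j : Fin 4) :
    Tendsto (fun s : ℝ => (W (s + Real.pi / 2 * Complex.I) * V s) i j) atBot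
      (𝓝 (if i = j then Complex.exp (-(μ i * (Real.pi / 2) * Complex.I)) else 0)) := by
  -- conjugation by `ε` removes the diagonal part; what remains is `O(e^{Re w})`
  let ε : Fin 4 → ℝ → ℂ := fun i s => Complex.exp (s * (μ i * (Real.pi / 2) * Complex.I))
  have hεn : ∀ i s, ‖ε i s‖ = 1 := by
    intro i s
    have : (s : ℂ) * (μ i * (Real.pi / 2) * Complex.I)
        = ((s * (μ i * (Real.pi / 2)) : ℝ) : ℂ) * Complex.I := by push_cast; ring
    simp only [ε]
    rw [this, Complex.norm_exp_ofReal_mul_I]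
  have hε : ∀ i s, HasDerivAt (ε i) (ε i s * (μ i * (Real.pi / 2) * Complex.I)) s := by
    intro i s
    have h1 : HasDerivAt (fun s : ℝ => (s : ℂ) * (μ i * (Real.pi / 2) * Complex.I))
        (μ i * (Real.pi / 2) * Complex.I) s := by
      simpa using (Complex.ofRealCLM.hasDerivAt (x := s)).mul_const
        ((μ i : ℂ) * (Real.pi / 2) * Complex.I)
    exact h1.cexp
  have key : ∀ s : ℝ, ‖ε i 1 * (W (s + Real.pi / 2 * Complex.I) * V s) i j
      - (if i = j then 1 else 0)‖ ≤ Real.exp (Real.pi / 2 * Real.exp s) - 1 := by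
    intro s
    let U : ℝ → Fin 4 → ℂ := fun r =>
      (W (s + r * (Real.pi / 2 * Complex.I))).mulVec fun k => V s k j
    have hU : ∀ (r : ℝ) i, HasDerivAt (fun r => U r i)
        ((Complex.exp (s + r * (Real.pi / 2 * Complex.I)) * U r (i + 1) - μ i * U r i)
          * (Real.pi / 2 * Complex.I)) r := by
      intro r i
      have h1 : HasDerivAt (fun r : ℝ => (s : ℂ) + r * (Real.pi / 2 * Complex.I))
          (Real.pi / 2 * Complex.I) r := by
        simpa using ((Complex.ofRealCLM.hasDerivAt (x := r)).mul_const
          ((Real.pi : ℂ) / 2 * Complex.I)).const_add (s : ℂ)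
      exact (isModelSolution_mulVec hW (fun k => V s k j) _ i).comp r h1
    let δ : Fin 4 → ℂ := Pi.single j 1
    let f : ℝ → Fin 4 → ℂ := fun r i => ε i r * U r i - δ i
    let f' : ℝ → Fin 4 → ℂ := fun r i => ε i r *
      (Complex.exp (s + r * (Real.pi / 2 * Complex.I)) * U r (i + 1) * (Real.pi / 2 * Complex.I))
    have hf : ∀ r, HasDerivAt f (f' r) r := by
      intro r
      refine hasDerivAt_pi.2 fun i => ?_
      convert! ((hε i r).mul (hU r i)).sub_const (δ i) using 1
      simp only [f']
      ring
    have hf0 : f 0 = 0 := by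
      funext i
      have : U 0 i = δ i := by
        have h2 : U 0 i = (W s * V s) i j := by
          simp [U, Matrix.mulVec, Matrix.mul_apply, dotProduct]
        rw [h2, hWV]
        simp [δ, Matrix.one_apply, Pi.single_apply]
      simp [f, ε, this]
    let K : ℝ := Real.pi / 2 * Real.exp s
    have hK : 0 < K := by positivity
    have hδ : ‖δ‖ ≤ 1 := by
      refine (pi_norm_le_iff_of_nonneg zero_le_one).2 fun i => ?_
      simp only [δ, Pi.single_apply]
      split_ifs <;> simp
    have hbd : ∀ r, ‖f' r‖ ≤ K * ‖f r‖ + K := by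
      intro r
      refine (pi_norm_le_iff_of_nonneg (by positivity)).2 fun i => ?_
      have h3 : ‖U r (i + 1)‖ ≤ ‖f r‖ + 1 := by
        have h4 : U r (i + 1) * ε (i + 1) r = f r (i + 1) + δ (i + 1) := by
          simp only [f]; ring
        have h5 : ‖U r (i + 1)‖ = ‖f r (i + 1) + δ (i + 1)‖ := by
          rw [← h4, norm_mul, hεn, mul_one]
        rw [h5]
        exact (norm_add_le _ _).trans (add_le_add (norm_le_pi_norm _ _)
          ((norm_le_pi_norm _ _).trans hδ))
      simp only [f']
      rw [norm_mul, hεn, one_mul, norm_mul, norm_mul, Complex.norm_exp]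
      have h6 : ((s : ℂ) + r * (Real.pi / 2 * Complex.I)).re = s := by
        simp
      have h7 : ‖(Real.pi : ℂ) / 2 * Complex.I‖ = Real.pi / 2 := by
        rw [norm_mul, Complex.norm_I, mul_one, ← Complex.ofReal_ofNat, ← Complex.ofReal_div,
          Complex.norm_real, Real.norm_of_nonneg (by positivity)]
      rw [h6, h7]
      calc Real.exp s * ‖U r (i + 1)‖ * (Real.pi / 2)
          ≤ Real.exp s * (‖f r‖ + 1) * (Real.pi / 2) := by gcongr
        _ = K * ‖f r‖ + K := by simp only [K]; ring
    have hg := norm_le_gronwallBound_of_norm_deriv_right_le (a := 0) (b := 1) (δ := 0)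
      (K := K) (ε := K) (fun r _ => (hf r).continuousAt.continuousWithinAt)
      (fun r _ => (hf r).hasDerivWithinAt) (by simp [hf0]) (fun r _ => hbd r) 1
      (right_mem_Icc.2 zero_le_one)
    rw [gronwallBound_of_K_ne_0 hK.ne'] at hg
    simp only [zero_mul, zero_add, sub_zero, mul_one, div_self hK.ne', one_mul] at hg
    refine le_trans ?_ hg
    refine le_trans (le_of_eq ?_) (norm_le_pi_norm (f 1) i)
    congr 1
    simp [f, U, δ, Matrix.mulVec, Matrix.mul_apply, dotProduct, Pi.single_apply]
  have hlim : Tendsto (fun s : ℝ => Real.exp (Real.pi / 2 * Real.exp s) - 1) atBot (𝓝 0) := by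
    have h1 : Tendsto (fun s : ℝ => Real.pi / 2 * Real.exp s) atBot (𝓝 0) := by
      simpa using Real.tendsto_exp_atBot.const_mul (Real.pi / 2)
    simpa using ((Real.continuous_exp.tendsto 0).comp h1).sub_const 1
  have h2 := (squeeze_zero_norm key hlim).add_const (if i = j then (1 : ℂ) else 0)
  have h3 := h2.const_mul (ε i 1)⁻¹
  have hε0 : ε i 1 ≠ 0 := Complex.exp_ne_zero _
  have hεinv : (ε i 1)⁻¹ = Complex.exp (-(μ i * (Real.pi / 2) * Complex.I)) := by
    simp [ε, Complex.exp_neg]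
  simp only [sub_add_cancel, ← mul_assoc, inv_mul_cancel₀ hε0, one_mul, zero_add] at h3
  rw [hεinv] at h3
  simpa using h3

theorem charpoly_eq_of_tendsto {M : Matrix (Fin 4) (Fin 4) ℂ} {d : Fin 4 → ℂ}
    {X : ℝ → Matrix (Fin 4) (Fin 4) ℂ} (hX : ∀ s, (X s).charpoly = M.charpoly)
    (hlim : Tendsto X atBot (𝓝 (Matrix.diagonal d))) :
    M.charpoly = ∏ i, (Polynomial.X - Polynomial.C (d i)) := by
  rw [← Matrix.charpoly_diagonal]
  refine Polynomial.funext fun z => ?_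
  have h1 : Continuous fun A : Matrix (Fin 4) (Fin 4) ℂ => A.charpoly.eval z := by
    simp only [Matrix.eval_charpoly]
    fun_prop
  have h2 := (h1.tendsto _).comp hlim
  simp only [Function.comp_def, hX] at h2
  exact tendsto_nhds_unique tendsto_const_nhds h2

theorem aeval_matrix_quartic {M : Matrix (Fin 4) (Fin 4) ℂ} {d : Fin 4 → ℂ}
    (h : M.charpoly = ∏ i, (Polynomial.X - Polynomial.C (d i))) :
    M ^ 4 - (d 0 + d 1 + d 2 + d 3) • M ^ 3
      + (d 0 * d 1 + d 0 * d 2 + d 0 * d 3 + d 1 * d 2 + d 1 * d 3 + d 2 * d 3) • M ^ 2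
      - (d 0 * d 1 * d 2 + d 0 * d 1 * d 3 + d 0 * d 2 * d 3 + d 1 * d 2 * d 3) • M
      + (d 0 * d 1 * d 2 * d 3) • (1 : Matrix (Fin 4) (Fin 4) ℂ) = 0 := by
  have h1 := Matrix.aeval_self_charpoly M
  have h2 : ∏ i, (Polynomial.X - Polynomial.C (d i))
      = Polynomial.X ^ 4 - Polynomial.C (d 0 + d 1 + d 2 + d 3) * Polynomial.X ^ 3
      + Polynomial.C (d 0 * d 1 + d 0 * d 2 + d 0 * d 3 + d 1 * d 2 + d 1 * d 3 + d 2 * d 3)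
        * Polynomial.X ^ 2
      - Polynomial.C (d 0 * d 1 * d 2 + d 0 * d 1 * d 3 + d 0 * d 2 * d 3 + d 1 * d 2 * d 3)
        * Polynomial.X
      + Polynomial.C (d 0 * d 1 * d 2 * d 3) := by
    simp only [Fin.prod_univ_four, Polynomial.C_add, Polynomial.C_mul]
    ring
  have h3 : ∀ e₁ e₂ e₃ e₄ : ℂ, Polynomial.aeval M (Polynomial.X ^ 4
      - Polynomial.C e₁ * Polynomial.X ^ 3 + Polynomial.C e₂ * Polynomial.X ^ 2
      - Polynomial.C e₃ * Polynomial.X + Polynomial.C e₄)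
      = M ^ 4 - e₁ • M ^ 3 + e₂ • M ^ 2 - e₃ • M + e₄ • (1 : Matrix (Fin 4) (Fin 4) ℂ) := by
    intros
    simp [Algebra.algebraMap_eq_smul_one]
  rwa [h, h2, h3] at h1

/-- Cayley–Hamilton for the rotation of solutions. The characteristic polynomial of the rotation is
that of the limit system at `x = 0`, also for resonant exponents. -/
theorem rotate_relation {μ : Fin 4 → ℝ} {Y : ℂ → Fin 4 → ℂ} (hY : IsModelSolution μ Y)
    {d : Fin 4 → ℂ} (hd : d = monodromyEigenvalue μ) (k : ℤ) (w : ℂ) (i : Fin 4) :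
    rotate (k + 4) Y w i - (d 0 + d 1 + d 2 + d 3) * rotate (k + 3) Y w i
      + (d 0 * d 1 + d 0 * d 2 + d 0 * d 3 + d 1 * d 2 + d 1 * d 3 + d 2 * d 3)
        * rotate (k + 2) Y w i
      - (d 0 * d 1 * d 2 + d 0 * d 1 * d 3 + d 0 * d 2 * d 3 + d 1 * d 2 * d 3)
        * rotate (k + 1) Y w i
      + (d 0 * d 1 * d 2 * d 3) * rotate k Y w i = 0 := by
  obtain ⟨W, V, hW, hV, hVW, hWV⟩ := exists_model_fundamental μ
  let D : Matrix (Fin 4) (Fin 4) ℂ := Matrix.diagonal fun i => Complex.I ^ (i : ℕ)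
  let τ : ℂ := Real.pi / 2 * Complex.I
  -- a solution is determined by its value at a point
  have huniq : ∀ Z, IsModelSolution μ Z → ∃ u, ∀ w, Z w = (W w).mulVec u := by
    intro Z hZ
    refine ⟨(V 0).mulVec (Z 0), fun w => ?_⟩
    have hconst : (V w).mulVec (Z w) = (V 0).mulVec (Z 0) := by
      funext i
      refine eq_of_hasDerivAt_zero_of_convex (f := fun w => (V w).mulVec (Z w) i) convex_univ
        (fun w _ => ?_) (mem_univ w) (mem_univ 0)
      have h1 : HasDerivAt (fun w => ∑ j, V w i j * Z w j)
          (∑ j, ((-(V w * modelMatrix μ w)) i j * Z w j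
            + V w i j * (modelMatrix μ w).mulVec (Z w) j)) w := by
        refine HasDerivAt.fun_sum fun j _ => (hV w i j).mul ?_
        rw [modelMatrix_mulVec]
        exact hZ w j
      convert! h1 using 1
      rw [Finset.sum_add_distrib]
      have h2 : ∑ j, V w i j * (modelMatrix μ w).mulVec (Z w) j
          = (V w * modelMatrix μ w).mulVec (Z w) i := by
        rw [← Matrix.mulVec_mulVec]; rfl
      rw [h2]
      simp [Matrix.mulVec, dotProduct]
    rw [← hconst, Matrix.mulVec_mulVec, hWV, Matrix.one_mulVec]
  have hcol : ∀ u : Fin 4 → ℂ, ∀ w,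
      rotate 1 (fun w => (W w).mulVec u) w = (D * W (w + τ)).mulVec u := by
    intro u w
    funext i
    rw [← Matrix.mulVec_mulVec, Matrix.mulVec_diagonal]
    simp [rotate, τ]
  let M : Matrix (Fin 4) (Fin 4) ℂ := V 0 * (D * W τ)
  have hM : ∀ w, D * W (w + τ) = W w * M := by
    intro w
    ext i j
    obtain ⟨u, hu⟩ := huniq _
      ((isModelSolution_mulVec hW (Pi.single j 1)).rotate 1)
    have h1 : u = M.mulVec (Pi.single j 1) := by
      have := hu 0
      rw [hcol] at this
      simp only [M]
      rw [← Matrix.mulVec_mulVec, ← zero_add τ, this, Matrix.mulVec_mulVec, hVW,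
        Matrix.one_mulVec]
    have h2 := hu w
    rw [hcol, h1, Matrix.mulVec_mulVec] at h2
    have h3 := congrFun h2 i
    rwa [Matrix.mulVec_single_one, Matrix.mulVec_single_one] at h3
  have hchar : M.charpoly = ∏ i, (Polynomial.X - Polynomial.C (d i)) := by
    refine charpoly_eq_of_tendsto (X := fun s : ℝ => D * (W (s + τ) * V s)) (fun s => ?_) ?_
    · rw [← Matrix.mul_assoc, hM, Matrix.charpoly_mul_comm, ← Matrix.mul_assoc, hVW,
        Matrix.one_mul]
    · have h1 : Tendsto (fun s : ℝ => W (s + τ) * V s) atBot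
          (𝓝 (Matrix.diagonal fun i => Complex.exp (-(μ i * (Real.pi / 2) * Complex.I)))) := by
        refine tendsto_pi_nhds.2 fun i => tendsto_pi_nhds.2 fun j => ?_
        simpa only [Matrix.diagonal_apply] using tendsto_transition hW hWV i j
      have h2 : Matrix.diagonal d = D * Matrix.diagonal fun i =>
          Complex.exp (-(μ i * (Real.pi / 2) * Complex.I)) := by
        rw [Matrix.diagonal_mul_diagonal, hd]
        rfl
      rw [h2]
      exact h1.const_mul D
  have hrel := aeval_matrix_quartic hchar
  obtain ⟨u, hu⟩ := huniq _ (hY.rotate k)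
  have hpow : ∀ n : ℕ, ∀ w, rotate (k + n) Y w = (W w).mulVec ((M ^ n).mulVec u) := by
    intro n
    induction n with
    | zero => intro w; simpa using hu w
    | succ n ih =>
      intro w
      have h1 : rotate (k + n) Y = fun w => (W w).mulVec ((M ^ n).mulVec u) := funext ih
      have h2 : rotate (k + (n + 1 : ℕ)) Y = rotate 1 (rotate (k + n) Y) := by
        rw [rotate_rotate]; congr 1; push_cast; ring
      rw [h2, h1, hcol, hM, Matrix.mulVec_mulVec, Matrix.mulVec_mulVec, pow_succ',
        Matrix.mul_assoc]
  have h4 := hpow 4 w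
  have h3 := hpow 3 w
  have h2 := hpow 2 w
  have h1 := hpow 1 w
  have h0 := hpow 0 w
  push_cast at h4 h3 h2 h1 h0
  rw [add_zero] at h0
  rw [h4, h3, h2, h1, h0]
  have h5 := congrFun (congrArg (fun A : Matrix (Fin 4) (Fin 4) ℂ =>
    (W w).mulVec (A.mulVec u)) hrel) i
  simpa [Matrix.add_mulVec, Matrix.sub_mulVec, Matrix.mulVec_add, Matrix.mulVec_sub,
    Matrix.smul_mulVec, Matrix.mulVec_smul] using h5

/-! ### Canonical solutions of the model system -/

theorem IsAsymptotic.rotate {μ : Fin 4 → ℝ} {Y : ℂ → Fin 4 → ℂ} {a b : ℝ} (k : ℤ)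
    (h : IsAsymptotic μ 1 Y (a + k * (Real.pi / 2)) (b + k * (Real.pi / 2))) :
    IsAsymptotic μ (Complex.I ^ k) (rotate k Y) a b := by
  intro n
  obtain ⟨K, R, hK⟩ := h n
  refine ⟨K, R, fun w hw ha hb i => ?_⟩
  have hre : (w + k * (Real.pi / 2) * Complex.I).re = w.re := by simp
  have him : (w + k * (Real.pi / 2) * Complex.I).im = w.im + k * (Real.pi / 2) := by simp
  have h1 := hK (w + k * (Real.pi / 2) * Complex.I) (by rw [hre]; exact hw)
    (by rw [him]; linarith) (by rw [him]; linarith) i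
  rw [hre, Complex.exp_add, exp_quarter_turns] at h1
  refine le_trans (le_of_eq ?_) h1
  have h2 : ‖(Complex.I ^ k) ^ (i : ℕ)‖ = 1 := by simp
  rw [← one_mul ‖_ - ∑ q ∈ Finset.range n, 1 ^ _ * _ * _‖, ← h2, ← norm_mul]
  congr 1
  rw [mul_sub, Finset.mul_sum, TTStarToda.rotate]
  congr 1
  · rw [one_mul, mul_comm (Complex.exp w)]; ring
  · refine Finset.sum_congr rfl fun q _ => ?_
    rw [one_pow, one_mul, one_mul, mul_comm (Complex.exp w)]; ring

/-- `Z = O(e^{-ζ x} x^{-n})` for all `n`, uniformly in the closed sector `a ≤ arg x ≤ b`. -/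
def IsDominated (ζ : ℂ) (Z : ℂ → Fin 4 → ℂ) (a b : ℝ) : Prop :=
  ∀ n : ℕ, ∃ K R : ℝ, ∀ w : ℂ, R ≤ w.re → a ≤ w.im → w.im ≤ b → ∀ i : Fin 4,
    ‖Complex.exp (ζ * Complex.exp w) * Z w i‖ ≤ K * Real.exp (-w.re) ^ n

theorem IsAsymptotic.add_dominated {μ : Fin 4 → ℝ} {ζ : ℂ} {Z Z' : ℂ → Fin 4 → ℂ} {a b : ℝ}
    (h : IsAsymptotic μ ζ Z a b) (h' : IsDominated ζ Z' a b) (c : ℂ) :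
    IsAsymptotic μ ζ (fun w i => Z w i + c * Z' w i) a b := by
  intro n
  obtain ⟨K, R, hK⟩ := h n
  obtain ⟨K', R', hK'⟩ := h' n
  refine ⟨K + ‖c‖ * K', max R R', fun w hw ha hb i => ?_⟩
  have h1 := hK w ((le_max_left _ _).trans hw) ha hb i
  have h2 := hK' w ((le_max_right _ _).trans hw) ha hb i
  rw [mul_add, add_sub_right_comm, add_mul, mul_left_comm, mul_assoc]
  refine (norm_add_le _ _).trans (add_le_add h1 ?_)
  rw [norm_mul]
  exact mul_le_mul_of_nonneg_left h2 (norm_nonneg c)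

theorem exp_neg_mul_le {ε X : ℝ} (hε : 0 < ε) (hX : 0 < X) (n : ℕ) :
    Real.exp (-(ε * X)) ≤ n.factorial / ε ^ n * X⁻¹ ^ n := by
  have h1 := Real.pow_div_factorial_le_exp (ε * X) (by positivity) n
  rw [Real.exp_neg]
  have h2 : 0 < (ε * X) ^ n / n.factorial := by positivity
  refine (inv_anti₀ h2 h1).trans (le_of_eq ?_)
  rw [inv_div, mul_pow, inv_pow]
  field_simp

/-- A solution with exponential factor `e^{-ζ' x}` is negligible against `e^{-ζ x}` where
`Re (ζ x) < Re (ζ' x)`. -/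
theorem IsAsymptotic.isDominated {μ : Fin 4 → ℝ} {ζ ζ' : ℂ} {Z : ℂ → Fin 4 → ℂ} {a b : ℝ}
    (h : IsAsymptotic μ ζ' Z a b)
    (hlt : ∀ α : ℝ, a ≤ α → α ≤ b →
      (ζ * Complex.exp (α * Complex.I)).re < (ζ' * Complex.exp (α * Complex.I)).re) :
    IsDominated ζ Z a b := by
  intro n
  rcases lt_or_ge b a with hab | hab
  · exact ⟨0, 0, fun w _ ha hb => absurd (ha.trans hb) (not_le.2 hab)⟩
  let g : ℝ → ℝ := fun α => ((ζ - ζ') * Complex.exp (α * Complex.I)).re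
  obtain ⟨α₀, hα₀, hmax⟩ := isCompact_Icc.exists_isMaxOn (nonempty_Icc.2 hab)
    (f := g) (by fun_prop)
  have hneg : g α₀ < 0 := by
    simp only [g]
    rw [sub_mul, Complex.sub_re]
    linarith [hlt α₀ hα₀.1 hα₀.2]
  obtain ⟨K, R, hK⟩ := h 0
  refine ⟨n.factorial / (-g α₀) ^ n * |K|, R, fun w hw ha hb i => ?_⟩
  have h1 := hK w hw ha hb i
  simp only [Finset.range_zero, Finset.sum_empty, sub_zero, pow_zero, mul_one] at h1
  have h2 : Complex.exp (ζ * Complex.exp w) * Z w i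
      = Complex.exp ((ζ - ζ') * Complex.exp w) * (Complex.exp (ζ' * Complex.exp w) * Z w i) := by
    rw [← mul_assoc, ← Complex.exp_add]
    congr 2
    ring
  have h3 : ((ζ - ζ') * Complex.exp w).re = Real.exp w.re * g w.im := by
    have : Complex.exp w = (Real.exp w.re : ℝ) * Complex.exp (w.im * Complex.I) := by
      rw [Complex.ofReal_exp, ← Complex.exp_add, Complex.re_add_im]
    rw [this, mul_left_comm, Complex.re_ofReal_mul]
  have h4 : g w.im ≤ g α₀ := hmax ⟨ha, hb⟩
  have h5 : ‖Complex.exp ((ζ - ζ') * Complex.exp w)‖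
      ≤ n.factorial / (-g α₀) ^ n * Real.exp (-w.re) ^ n := by
    rw [Complex.norm_exp, h3, Real.exp_neg]
    refine le_trans (Real.exp_le_exp.2 ?_) (exp_neg_mul_le (neg_pos.2 hneg) (Real.exp_pos w.re) n)
    nlinarith [mul_le_mul_of_nonneg_left h4 (Real.exp_pos w.re).le]
  rw [h2, norm_mul]
  have hng := neg_pos.2 hneg
  calc _ ≤ (n.factorial / (-g α₀) ^ n * Real.exp (-w.re) ^ n) * |K| :=
        mul_le_mul h5 (h1.trans (le_abs_self K)) (norm_nonneg _) (by positivity)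
    _ = _ := by ring

theorem IsModelSolution.add_mul {μ : Fin 4 → ℝ} {Z Z' : ℂ → Fin 4 → ℂ}
    (h : IsModelSolution μ Z) (h' : IsModelSolution μ Z') (c : ℂ) :
    IsModelSolution μ fun w i => Z w i + c * Z' w i := by
  intro w i
  convert! (h w i).add ((h' w i).const_mul c) using 1
  ring

/-- A solution of the model system asymptotic, in the open sector `A < arg x < B`, to the formal
solution with the exponential factor `e^{-i^k x}`. -/
def IsModelCanonical (μ : Fin 4 → ℝ) (k : ℤ) (A B : ℝ) (Z : ℂ → Fin 4 → ℂ) : Prop :=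
  IsModelSolution μ Z ∧ ∀ a b, A < a → b < B → IsAsymptotic μ (Complex.I ^ k) Z a b

theorem IsModelCanonical.mono {μ : Fin 4 → ℝ} {k : ℤ} {A B A' B' : ℝ} {Z : ℂ → Fin 4 → ℂ}
    (h : IsModelCanonical μ k A B Z) (hA : A ≤ A') (hB : B' ≤ B) :
    IsModelCanonical μ k A' B' Z :=
  ⟨h.1, fun a b ha hb => h.2 a b (hA.trans_lt ha) (hb.trans_le hB)⟩

theorem IsModelCanonical.union {μ : Fin 4 → ℝ} {k : ℤ} {A B A' B' : ℝ} {Z : ℂ → Fin 4 → ℂ}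
    (h : IsModelCanonical μ k A B' Z) (h' : IsModelCanonical μ k A' B Z) (hlt : A' < B') :
    IsModelCanonical μ k A B Z :=
  ⟨h.1, fun a b ha hb => (h.2 a ((A' + B') / 2) ha (by linarith)).union
    (h'.2 ((A' + B') / 2) b (by linarith) hb)⟩

theorem IsModelCanonical.add_mul {μ : Fin 4 → ℝ} {k k' : ℤ} {A B : ℝ} {Z Z' : ℂ → Fin 4 → ℂ}
    (h : IsModelCanonical μ k A B Z) (h' : IsModelCanonical μ k' A B Z') (c : ℂ)
    (hlt : ∀ α : ℝ, A < α → α < B →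
      (Complex.I ^ k * Complex.exp (α * Complex.I)).re
        < (Complex.I ^ k' * Complex.exp (α * Complex.I)).re) :
    IsModelCanonical μ k A B fun w i => Z w i + c * Z' w i :=
  ⟨h.1.add_mul h'.1 c, fun a b ha hb => (h.2 a b ha hb).add_dominated
    ((h'.2 a b ha hb).isDominated fun α h1 h2 => hlt α (ha.trans_le h1) (h2.trans_lt hb)) c⟩

theorem sin_add_cos_pos {α : ℝ} (h1 : -(Real.pi / 4) < α) (h2 : α < 3 * Real.pi / 4) :
    0 < Real.sin α + Real.cos α := by
  have h := Real.sin_pos_of_pos_of_lt_pi (x := α + Real.pi / 4) (by linarith) (by linarith)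
  rw [Real.sin_add, Real.cos_pi_div_four, Real.sin_pi_div_four, ← add_mul] at h
  exact pos_of_mul_pos_left h (by positivity)

theorem cos_lt_sin {α : ℝ} (h1 : Real.pi / 4 < α) (h2 : α < 5 * Real.pi / 4) :
    Real.cos α < Real.sin α := by
  have h := sin_add_cos_pos (α := α - Real.pi / 2) (by linarith) (by linarith)
  rw [Real.sin_sub_pi_div_two, Real.cos_sub_pi_div_two] at h
  linarith

theorem sin_lt_cos {α : ℝ} (h1 : -(3 * Real.pi / 4) < α) (h2 : α < Real.pi / 4) :
    Real.sin α < Real.cos α := by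
  have h := sin_add_cos_pos (α := -α) (by linarith) (by linarith)
  rw [Real.sin_neg, Real.cos_neg] at h
  linarith

/-- The canonical solutions of the model system in the three sectors, in terms of the rotations
`G_k` of the recessive solution. The compound ones are valid in two overlapping sectors, by the two
expressions for them that the five-term monodromy relation gives. -/
theorem exists_model_canonical {μ : Fin 4 → ℝ} (hμ : ∑ i, μ i = 0) {e₁ e₂ e₃ : ℂ}
    (hrel : ∀ Y, IsModelSolution μ Y → ∀ (k : ℤ) w i,
      rotate (k + 4) Y w i - e₁ * rotate (k + 3) Y w i + e₂ * rotate (k + 2) Y w i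
        - e₃ * rotate (k + 1) Y w i - rotate k Y w i = 0) :
    ∃ G : ℤ → ℂ → Fin 4 → ℂ,
      IsModelCanonical μ (-2) (-(Real.pi / 4)) (9 * Real.pi / 4) (G (-2)) ∧
      IsModelCanonical μ (-1) (-(3 * Real.pi / 4)) (7 * Real.pi / 4) (G (-1)) ∧
      IsModelCanonical μ 0 (-(5 * Real.pi / 4)) (5 * Real.pi / 4) (G 0) ∧
      IsModelCanonical μ 1 (-(7 * Real.pi / 4)) (3 * Real.pi / 4) (G 1) ∧
      IsModelCanonical μ (-2) (-(Real.pi / 2)) (3 * Real.pi / 4)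
        (fun w i => G (-2) w i + e₃ * G (-1) w i) ∧
      IsModelCanonical μ 1 (-(Real.pi / 4)) Real.pi (fun w i => G 1 w i + -e₁ * G 0 w i) ∧
      IsModelCanonical μ 1 0 (5 * Real.pi / 4)
        (fun w i => (G 1 w i + -e₁ * G 0 w i) + e₂ * G (-1) w i) := by
  obtain ⟨Y, hY, hasym⟩ := exists_recessive_solution hμ
  have hp := Real.pi_pos
  have hG : ∀ (k : ℤ) (A B : ℝ), -(5 * Real.pi / 4) ≤ A + k * (Real.pi / 2) →
      B + k * (Real.pi / 2) ≤ 5 * Real.pi / 4 → IsModelCanonical μ k A B (rotate k Y) :=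
    fun k A B hA hB => ⟨hY.rotate k, fun a b ha hb =>
      (hasym _ _ (by linarith) (by linarith)).rotate k⟩
  have c0 : ∀ α : ℝ, (Complex.I ^ (0 : ℤ) * Complex.exp (α * Complex.I)).re = Real.cos α := by
    intro α
    rw [zpow_zero, one_mul, Complex.exp_ofReal_mul_I_re]
  have c1 : ∀ α : ℝ, (Complex.I ^ (1 : ℤ) * Complex.exp (α * Complex.I)).re = -Real.sin α := by
    intro α
    rw [zpow_one, Complex.I_mul_re, Complex.exp_ofReal_mul_I_im]
  have c2 : ∀ α : ℝ, (Complex.I ^ (2 : ℤ) * Complex.exp (α * Complex.I)).re = -Real.cos α := by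
    intro α
    rw [show (2 : ℤ) = ((2 : ℕ) : ℤ) from rfl, zpow_natCast, Complex.I_sq, neg_one_mul,
      Complex.neg_re, Complex.exp_ofReal_mul_I_re]
  have i2 : Complex.I ^ (-2 : ℤ) = Complex.I ^ (2 : ℤ) := by
    rw [zpow_neg, show (2 : ℤ) = ((2 : ℕ) : ℤ) from rfl, zpow_natCast, Complex.I_sq]; norm_num
  have i3 : Complex.I ^ (-3 : ℤ) = Complex.I ^ (1 : ℤ) := by
    rw [zpow_neg, show (3 : ℤ) = ((3 : ℕ) : ℤ) from rfl, zpow_natCast, Complex.I_pow_three, zpow_one,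
      inv_neg, Complex.inv_I, neg_neg]
  have c1' : ∀ α : ℝ, (Complex.I ^ (-1 : ℤ) * Complex.exp (α * Complex.I)).re = Real.sin α := by
    intro α
    rw [zpow_neg_one, Complex.inv_I, neg_mul, Complex.neg_re, Complex.I_mul_re,
      Complex.exp_ofReal_mul_I_im, neg_neg]
  have c2' : ∀ α : ℝ, (Complex.I ^ (-2 : ℤ) * Complex.exp (α * Complex.I)).re = -Real.cos α := by
    intro α; rw [i2, c2]
  have c3' : ∀ α : ℝ, (Complex.I ^ (-3 : ℤ) * Complex.exp (α * Complex.I)).re = -Real.sin α := by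
    intro α; rw [i3, c1]
  have e2 : ∀ A B Z, IsModelCanonical μ 2 A B Z → IsModelCanonical μ (-2) A B Z := by
    intro A B Z h
    rwa [IsModelCanonical, i2]
  have e3 : ∀ A B Z, IsModelCanonical μ (-3) A B Z → IsModelCanonical μ 1 A B Z := by
    intro A B Z h
    rwa [IsModelCanonical, ← i3]
  refine ⟨fun k => rotate k Y, hG _ _ _ ?_ ?_, hG _ _ _ ?_ ?_, hG _ _ _ ?_ ?_, hG _ _ _ ?_ ?_,
    ?_, ?_, ?_⟩
  iterate 8 · push_cast; linarith
  · have hR : IsModelCanonical μ (-2) (-(Real.pi / 4)) (3 * Real.pi / 4)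
        (fun w i => rotate (-2) Y w i + e₃ * rotate (-1) Y w i) := by
      refine (hG _ _ _ ?_ ?_).add_mul (hG _ _ _ ?_ ?_) _ fun α h1 h2 => ?_
      iterate 4 · push_cast; linarith
      rw [c2', c1']
      linarith [sin_add_cos_pos h1 h2]
    have hL : IsModelCanonical μ 2 (-(Real.pi / 2)) (Real.pi / 4)
        (fun w i => (rotate 2 Y w i + -e₁ * rotate 1 Y w i) + e₂ * rotate 0 Y w i) := by
      refine ((hG _ _ _ ?_ ?_).add_mul (hG _ _ _ ?_ ?_) _ fun α h1 h2 => ?_).add_mul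
        (hG _ _ _ ?_ ?_) _ fun α h1 h2 => ?_
      iterate 4 · push_cast; linarith
      · rw [c2, c1]
        linarith [sin_lt_cos (α := α) (by linarith) h2]
      iterate 2 · push_cast; linarith
      · rw [c2, c0]
        linarith [Real.cos_pos_of_mem_Ioo ⟨h1, (by linarith : α < Real.pi / 2)⟩]
    have heq : (fun w i => (rotate 2 Y w i + -e₁ * rotate 1 Y w i) + e₂ * rotate 0 Y w i)
        = fun w i => rotate (-2) Y w i + e₃ * rotate (-1) Y w i := by
      funext w i
      have h := hrel Y hY (-2) w i
      norm_num at h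
      linear_combination h
    rw [heq] at hL
    exact (e2 _ _ _ hL).union hR (by linarith)
  · have hL : IsModelCanonical μ 1 (-(Real.pi / 4)) (3 * Real.pi / 4)
        (fun w i => rotate 1 Y w i + -e₁ * rotate 0 Y w i) := by
      refine (hG _ _ _ ?_ ?_).add_mul (hG _ _ _ ?_ ?_) _ fun α h1 h2 => ?_
      iterate 4 · push_cast; linarith
      rw [c1, c0]
      linarith [sin_add_cos_pos h1 h2]
    have hR : IsModelCanonical μ (-3) (Real.pi / 4) Real.pi
        (fun w i => (rotate (-3) Y w i + e₃ * rotate (-2) Y w i) + -e₂ * rotate (-1) Y w i) := by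
      refine ((hG _ _ _ ?_ ?_).add_mul (hG _ _ _ ?_ ?_) _ fun α h1 h2 => ?_).add_mul
        (hG _ _ _ ?_ ?_) _ fun α h1 h2 => ?_
      iterate 4 · push_cast; linarith
      · rw [c3', c2']
        linarith [cos_lt_sin (α := α) h1 (by linarith)]
      iterate 2 · push_cast; linarith
      · rw [c3', c1']
        linarith [Real.sin_pos_of_pos_of_lt_pi (x := α) (by linarith) h2]
    have heq : (fun w i => (rotate (-3) Y w i + e₃ * rotate (-2) Y w i) + -e₂ * rotate (-1) Y w i)
        = fun w i => rotate 1 Y w i + -e₁ * rotate 0 Y w i := by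
      funext w i
      have h := hrel Y hY (-3) w i
      norm_num at h
      linear_combination -h
    rw [heq] at hR
    exact hL.union (e3 _ _ _ hR) (by linarith)
  · have hL : IsModelCanonical μ 1 0 (3 * Real.pi / 4)
        (fun w i => (rotate 1 Y w i + -e₁ * rotate 0 Y w i) + e₂ * rotate (-1) Y w i) := by
      refine ((hG _ _ _ ?_ ?_).add_mul (hG _ _ _ ?_ ?_) _ fun α h1 h2 => ?_).add_mul
        (hG _ _ _ ?_ ?_) _ fun α h1 h2 => ?_
      iterate 4 · push_cast; linarith
      · rw [c1, c0]
        linarith [sin_add_cos_pos (α := α) (by linarith) h2]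
      iterate 2 · push_cast; linarith
      · rw [c1, c1']
        linarith [Real.sin_pos_of_pos_of_lt_pi (x := α) h1 (by linarith)]
    have hR : IsModelCanonical μ (-3) (Real.pi / 4) (5 * Real.pi / 4)
        (fun w i => rotate (-3) Y w i + e₃ * rotate (-2) Y w i) := by
      refine (hG _ _ _ ?_ ?_).add_mul (hG _ _ _ ?_ ?_) _ fun α h1 h2 => ?_
      iterate 4 · push_cast; linarith
      rw [c3', c2']
      linarith [cos_lt_sin (α := α) h1 h2]
    have heq : (fun w i => rotate (-3) Y w i + e₃ * rotate (-2) Y w i)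
        = fun w i => (rotate 1 Y w i + -e₁ * rotate 0 Y w i) + e₂ * rotate (-1) Y w i := by
      funext w i
      have h := hrel Y hY (-3) w i
      norm_num at h
      linear_combination -h
    rw [heq] at hR
    exact hL.union (e3 _ _ _ hR) (by linarith)

/-! ### The Stokes parameters as symmetric functions of the monodromy eigenvalues -/

/-- The diagonal of `m`. -/
def mVec (k : Fin 4 → ℝ) : Fin 4 → ℝ := ![m0 k, m1 k, -m1 k, -m0 k]

theorem sum_mVec (k : Fin 4 → ℝ) : ∑ i, mVec k i = 0 := by
  simp [mVec, Fin.sum_univ_four]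

/-- The Stokes parameter in `P_1`. -/
def stokes1 (k : Fin 4 → ℝ) : ℝ :=
  2 * Real.cos (Real.pi / 4 * (2 * m0 k + 3)) + 2 * Real.cos (Real.pi / 4 * (2 * m1 k + 1))

/-- The Stokes parameter in `P_{5/4}`. -/
def stokes2 (k : Fin 4 → ℝ) : ℝ :=
  -2 + 2 * Real.cos (Real.pi / 2 * (m0 k + m1 k)) + 2 * Real.sin (Real.pi / 2 * (m0 k - m1 k))

theorem omegaPow_add (a b : ℝ) : omegaPow (a + b) = omegaPow a * omegaPow b := by
  rw [omegaPow, omegaPow, omegaPow, ← Complex.exp_add]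
  congr 1
  push_cast
  ring

theorem omegaPow_one : omegaPow 1 = Complex.I := by
  rw [omegaPow, Complex.ofReal_one, mul_one, Complex.exp_pi_div_two_mul_I]

theorem omegaPow_two : omegaPow 2 = -1 := by
  rw [show (2 : ℝ) = 1 + 1 by norm_num, omegaPow_add, omegaPow_one, Complex.I_mul_I]

theorem omegaPow_eq_I_mul {a b : ℝ} (h : a = 1 + b) : omegaPow a = Complex.I * omegaPow b := by
  rw [h, omegaPow_add, omegaPow_one]

theorem omegaPow_eq_neg {a b : ℝ} (h : a = 2 + b) : omegaPow a = -omegaPow b := by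
  rw [h, omegaPow_add, omegaPow_two, neg_one_mul]

theorem omegaPow_eq {a b : ℝ} (h : a = 4 + b) : omegaPow a = omegaPow b := by
  rw [h, show (4 : ℝ) + b = 2 + (2 + b) by ring, omegaPow_eq_neg rfl, omegaPow_eq_neg rfl, neg_neg]

theorem omegaPow_natCast (n : ℕ) : omegaPow n = Complex.I ^ n := by
  rw [← omegaPow_one, omegaPow, omegaPow, ← Complex.exp_nat_mul]
  congr 1
  push_cast
  ring

theorem two_cos_eq_omegaPow (a : ℝ) :
    (2 * Real.cos (Real.pi / 2 * a) : ℂ) = omegaPow a + omegaPow (-a) := by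
  rw [Complex.ofReal_cos, Complex.two_cos, omegaPow, omegaPow]
  push_cast
  congr 2 <;> ring

theorem two_sin_eq_omegaPow (a : ℝ) :
    (2 * Real.sin (Real.pi / 2 * a) : ℂ) = -Complex.I * (omegaPow a - omegaPow (-a)) := by
  rw [Complex.ofReal_sin, Complex.two_sin, omegaPow, omegaPow]
  push_cast
  have h1 : (Real.pi : ℂ) / 2 * Complex.I * a = Real.pi / 2 * a * Complex.I := by ring
  have h2 : (Real.pi : ℂ) / 2 * Complex.I * -a = -(Real.pi / 2 * a) * Complex.I := by ring
  rw [h1, h2]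
  ring

theorem stokes1_eq_omegaPow (k : Fin 4 → ℝ) :
    (stokes1 k : ℂ) = omegaPow (m0 k + 3 / 2) + omegaPow (-m0 k - 3 / 2)
      + omegaPow (m1 k + 1 / 2) + omegaPow (-m1 k - 1 / 2) := by
  have h1 := two_cos_eq_omegaPow (m0 k + 3 / 2)
  have h2 := two_cos_eq_omegaPow (m1 k + 1 / 2)
  rw [stokes1, show Real.pi / 4 * (2 * m0 k + 3) = Real.pi / 2 * (m0 k + 3 / 2) by ring,
    show Real.pi / 4 * (2 * m1 k + 1) = Real.pi / 2 * (m1 k + 1 / 2) by ring]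
  push_cast at h1 h2 ⊢
  rw [h1, h2, neg_add', neg_add']
  ring

theorem stokes2_eq_omegaPow (k : Fin 4 → ℝ) :
    (stokes2 k : ℂ) = -2 + omegaPow (m0 k + m1 k) + omegaPow (-(m0 k + m1 k))
      - Complex.I * (omegaPow (m0 k - m1 k) - omegaPow (-(m0 k - m1 k))) := by
  have h1 := two_cos_eq_omegaPow (m0 k + m1 k)
  have h2 := two_sin_eq_omegaPow (m0 k - m1 k)
  rw [stokes2]
  push_cast at h1 h2 ⊢
  rw [h1, h2]
  ring

theorem monodromyEigenvalue_mVec (k : Fin 4 → ℝ) :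
    monodromyEigenvalue (mVec k) = ![omegaPow (-m0 k), omegaPow (1 - m1 k), omegaPow (2 + m1 k),
      omegaPow (3 + m0 k)] := by
  funext i
  have h : ∀ (n : ℕ) (a : ℝ), Complex.I ^ n * Complex.exp (-(a * (Real.pi / 2) * Complex.I))
      = omegaPow (n + -a) := by
    intro n a
    rw [omegaPow_add, omegaPow_natCast, omegaPow]
    congr 2
    push_cast
    ring
  rw [monodromyEigenvalue, h]
  fin_cases i <;> simp [mVec, sub_eq_add_neg]

/-- The monodromy relation for `μ = m`, with its coefficients in terms of the Stokes parameters. -/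
theorem monodromy_relation_mVec (k : Fin 4 → ℝ) (Y : ℂ → Fin 4 → ℂ)
    (hY : IsModelSolution (mVec k) Y) (n : ℤ) (w : ℂ) (i : Fin 4) :
    rotate (n + 4) Y w i - (-(omegaPow (-1 / 2) * stokes1 k)) * rotate (n + 3) Y w i
        + (omegaPow 1 * stokes2 k) * rotate (n + 2) Y w i
        - (-(omegaPow (5 / 2) * stokes1 k)) * rotate (n + 1) Y w i - rotate n Y w i = 0 := by
  have h := rotate_relation hY (monodromyEigenvalue_mVec k).symm n w i
  simp only [Matrix.cons_val] at h
  have f1 : omegaPow (-m0 k) + omegaPow (1 - m1 k) + omegaPow (2 + m1 k) + omegaPow (3 + m0 k)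
      = -(omegaPow (-1 / 2) * stokes1 k) := by
    rw [stokes1_eq_omegaPow, mul_add, mul_add, mul_add, ← omegaPow_add, ← omegaPow_add,
      ← omegaPow_add, ← omegaPow_add]
    have q1 : omegaPow (-m0 k) = -omegaPow (-1 / 2 + (-m0 k - 3 / 2)) :=
      omegaPow_eq_neg (by ring)
    have q2 : omegaPow (1 - m1 k) = -omegaPow (-1 / 2 + (-m1 k - 1 / 2)) :=
      omegaPow_eq_neg (by ring)
    have q3 : omegaPow (2 + m1 k) = -omegaPow (-1 / 2 + (m1 k + 1 / 2)) :=
      omegaPow_eq_neg (by ring)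
    have q4 : omegaPow (3 + m0 k) = -omegaPow (-1 / 2 + (m0 k + 3 / 2)) :=
      omegaPow_eq_neg (by ring)
    rw [q1, q2, q3, q4]
    ring
  have f2 : omegaPow (-m0 k) * omegaPow (1 - m1 k) + omegaPow (-m0 k) * omegaPow (2 + m1 k)
      + omegaPow (-m0 k) * omegaPow (3 + m0 k) + omegaPow (1 - m1 k) * omegaPow (2 + m1 k)
      + omegaPow (1 - m1 k) * omegaPow (3 + m0 k) + omegaPow (2 + m1 k) * omegaPow (3 + m0 k)
      = omegaPow 1 * stokes2 k := by
    have g1 : omegaPow (-m0 k) * omegaPow (1 - m1 k) = Complex.I * omegaPow (-(m0 k + m1 k)) := by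
      rw [← omegaPow_add]; exact omegaPow_eq_I_mul (by ring)
    have g2 : omegaPow (-m0 k) * omegaPow (2 + m1 k) = -omegaPow (-(m0 k - m1 k)) := by
      rw [← omegaPow_add]; exact omegaPow_eq_neg (by ring)
    have g3 : omegaPow (-m0 k) * omegaPow (3 + m0 k) = -Complex.I := by
      rw [← omegaPow_add, ← omegaPow_one]; exact omegaPow_eq_neg (by ring)
    have g4 : omegaPow (1 - m1 k) * omegaPow (2 + m1 k) = -Complex.I := by
      rw [← omegaPow_add, ← omegaPow_one]; exact omegaPow_eq_neg (by ring)
    have g5 : omegaPow (1 - m1 k) * omegaPow (3 + m0 k) = omegaPow (m0 k - m1 k) := by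
      rw [← omegaPow_add]; exact omegaPow_eq (by ring)
    have g6 : omegaPow (2 + m1 k) * omegaPow (3 + m0 k) = Complex.I * omegaPow (m0 k + m1 k) := by
      rw [← omegaPow_add, ← omegaPow_eq_I_mul rfl]; exact omegaPow_eq (by ring)
    rw [g1, g2, g3, g4, g5, g6, stokes2_eq_omegaPow, omegaPow_one]
    linear_combination (omegaPow (m0 k - m1 k) - omegaPow (-(m0 k - m1 k))) * Complex.I_sq
  have f3 : omegaPow (-m0 k) * omegaPow (1 - m1 k) * omegaPow (2 + m1 k)
      + omegaPow (-m0 k) * omegaPow (1 - m1 k) * omegaPow (3 + m0 k)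
      + omegaPow (-m0 k) * omegaPow (2 + m1 k) * omegaPow (3 + m0 k)
      + omegaPow (1 - m1 k) * omegaPow (2 + m1 k) * omegaPow (3 + m0 k)
      = -(omegaPow (5 / 2) * stokes1 k) := by
    rw [stokes1_eq_omegaPow, mul_add, mul_add, mul_add]
    simp only [← omegaPow_add]
    have q1 : omegaPow (-m0 k + (1 - m1 k) + (2 + m1 k))
        = -omegaPow (5 / 2 + (-m0 k - 3 / 2)) :=
      omegaPow_eq_neg (by ring)
    have q2 : omegaPow (-m0 k + (1 - m1 k) + (3 + m0 k))
        = -omegaPow (5 / 2 + (-m1 k - 1 / 2)) :=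
      omegaPow_eq_neg (by ring)
    have q3 : omegaPow (-m0 k + (2 + m1 k) + (3 + m0 k))
        = -omegaPow (5 / 2 + (m1 k + 1 / 2)) :=
      omegaPow_eq_neg (by ring)
    have q4 : omegaPow (1 - m1 k + (2 + m1 k) + (3 + m0 k))
        = -omegaPow (5 / 2 + (m0 k + 3 / 2)) :=
      omegaPow_eq_neg (by ring)
    rw [q1, q2, q3, q4]
    ring
  have f4 : omegaPow (-m0 k) * omegaPow (1 - m1 k) * omegaPow (2 + m1 k) * omegaPow (3 + m0 k)
      = -1 := by
    simp only [← omegaPow_add]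
    rw [← omegaPow_two]; exact omegaPow_eq (by ring)
  rw [f1, f2, f3, f4] at h
  linear_combination h

/-! ### The gauge transformation by `h` -/

/-- The diagonal of `h`. -/
def hVec (c k : Fin 4 → ℝ) (l : ℂ) : Fin 4 → ℂ :=
  ![h0 c k l, h1 c k l, (h1 c k l)⁻¹, (h0 c k l)⁻¹]

/-- The logarithm of `p_i`. -/
def logP (c k : Fin 4 → ℝ) (l : ℂ) (i : Fin 4) : ℂ := Real.log (c i) + k i * l

theorem p_eq_exp {c : Fin 4 → ℝ} (k : Fin 4 → ℝ) (l : ℂ) {i : Fin 4} (hc : 0 < c i) :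
    p c k l i = Complex.exp (logP c k l i) := by
  rw [p, logP, Complex.exp_add, ← Complex.ofReal_exp, Real.exp_log hc]

theorem pPow_eq_exp {c : Fin 4 → ℝ} (k : Fin 4 → ℝ) (l : ℂ) {i : Fin 4} (hc : 0 < c i) (a : ℝ) :
    pPow c k l i a = Complex.exp (a * logP c k l i) := by
  rw [pPow, logP, Real.rpow_def_of_pos hc, Complex.ofReal_exp, ← Complex.exp_add]
  congr 1
  push_cast
  ring

theorem t_eq_exp {c k : Fin 4 → ℝ} (l : ℂ) (hc : ∀ i, 0 < c i) :
    t c k l = 4 / N k * Complex.exp ((logP c k l 0 + logP c k l 1 + logP c k l 2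
      + logP c k l 3) / 4 + l) := by
  have hprod : 0 < ∏ i, c i := Finset.prod_pos fun i _ => hc i
  rw [t, Real.rpow_def_of_pos hprod, Complex.ofReal_exp, mul_assoc, ← Complex.exp_add]
  congr 2
  rw [Real.log_prod (fun i _ => (hc i).ne'), N]
  simp only [Fin.sum_univ_four, logP]
  push_cast
  ring

theorem hVec_ne_zero {c : Fin 4 → ℝ} (k : Fin 4 → ℝ) (l : ℂ) (hc : ∀ i, 0 < c i) (i : Fin 4) :
    hVec c k l i ≠ 0 := by
  have e0 : h0 c k l ≠ 0 := by
    simp only [h0, pPow_eq_exp k l (hc _)]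
    exact mul_ne_zero (mul_ne_zero (Complex.exp_ne_zero _) (Complex.exp_ne_zero _))
      (Complex.exp_ne_zero _)
  have e1 : h1 c k l ≠ 0 := by
    simp only [h1, pPow_eq_exp k l (hc _)]
    exact mul_ne_zero (mul_ne_zero (Complex.exp_ne_zero _) (Complex.exp_ne_zero _))
      (Complex.exp_ne_zero _)
  fin_cases i <;> simp [hVec, e0, e1]

/-- Conjugation by `h` turns `(4/N) z ηᵀ` into `t` times the cyclic shift. -/
theorem eta_hVec {c k : Fin 4 → ℝ} (l : ℂ) (hc : ∀ i, 0 < c i) (hc13 : c 1 = c 3)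
    (hk13 : k 1 = k 3) (i : Fin 4) :
    4 / N k * Complex.exp l * p c k l (i + 1) * hVec c k l (i + 1) = t c k l * hVec c k l i := by
  have h13 : logP c k l 3 = logP c k l 1 := by rw [logP, logP, hc13, hk13]
  rw [t_eq_exp l hc, h13]
  have e0 : h0 c k l = Complex.exp (-3 / 8 * logP c k l 0 + 2 / 8 * logP c k l 1
      + 1 / 8 * logP c k l 2) := by
    simp only [h0, pPow_eq_exp k l (hc _), ← Complex.exp_add]
    push_cast
    rfl
  have e1 : h1 c k l = Complex.exp (-1 / 8 * logP c k l 0 + -2 / 8 * logP c k l 1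
      + 3 / 8 * logP c k l 2) := by
    simp only [h1, pPow_eq_exp k l (hc _), ← Complex.exp_add]
    push_cast
    rfl
  simp only [hVec, e0, e1, p_eq_exp k l (hc _), ← Complex.exp_neg]
  fin_cases i
  · simp only [mul_assoc, ← Complex.exp_add]
    simp [← Complex.exp_add]
    left
    congr 1; ring
  · simp only [mul_assoc, ← Complex.exp_add]
    simp [← Complex.exp_add]
    left
    congr 1; ring
  · simp only [mul_assoc, ← Complex.exp_add]
    simp [← Complex.exp_add, h13]
    left
    congr 1; ring
  · simp only [mul_assoc, ← Complex.exp_add]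
    simp [← Complex.exp_add]
    left
    congr 1; ring

theorem etaTranspose_mul_apply {c k : Fin 4 → ℝ} {l : ℂ} (X : Matrix (Fin 4) (Fin 4) ℂ)
    (i j : Fin 4) : ((eta c k l).transpose * X) i j = p c k l (i + 1) * X (i + 1) j := by
  fin_cases i <;> simp [eta, Matrix.mul_apply, Fin.sum_univ_four]

theorem m_mul_apply (k : Fin 4 → ℝ) (X : Matrix (Fin 4) (Fin 4) ℂ) (i j : Fin 4) :
    (m k * X) i j = mVec k i * X i j := by
  rw [m, Matrix.diagonal_mul]
  fin_cases i <;> simp [mVec]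

/-- The rotation `i^(j-2) = -ω^j` that takes the column with exponential factor `e^{-x}` to the `j`-th
one. -/
def colRot (j : Fin 4) : ℂ := Complex.I ^ ((j : ℤ) - 2)

theorem colRot_eq (j : Fin 4) : colRot j = -omegaPow (j.val : ℝ) := by
  have h : Complex.I ^ (-2 : ℤ) = -1 := by
    rw [zpow_neg, show (2 : ℤ) = ((2 : ℕ) : ℤ) from rfl, zpow_natCast, Complex.I_sq]; norm_num
  rw [colRot, omegaPow_natCast, sub_eq_add_neg, zpow_add₀ Complex.I_ne_zero, h, zpow_natCast]
  ring

theorem colRot_pow_four (j : Fin 4) : colRot j ^ 4 = 1 := I_zpow_pow_four _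

theorem colRot_ne_zero (j : Fin 4) : colRot j ≠ 0 := I_zpow_ne_zero _

theorem Omega_eq : Omega = !![1, 1, 1, 1;
    1, Complex.I, -1, -Complex.I; 1, -1, 1, -1; 1, -Complex.I, -1, Complex.I] := by
  ext i j
  have h4 : Complex.I ^ 4 = 1 := Complex.I_pow_four
  have h6 : Complex.I ^ 6 = -1 := by rw [Complex.I_pow_eq_pow_mod]; norm_num
  have h9 : Complex.I ^ 9 = Complex.I := by rw [Complex.I_pow_eq_pow_mod]; norm_num
  rw [Omega, Matrix.of_apply, omegaPow_natCast]
  fin_cases i <;> fin_cases j <;> simp [Complex.I_pow_three, h4, h6, h9]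

/-- The inverse of `Ω`. -/
def OmegaInv : Matrix (Fin 4) (Fin 4) ℂ := (1 / 4 : ℂ) • !![1, 1, 1, 1;
    1, -Complex.I, -1, Complex.I; 1, -1, 1, -1; 1, Complex.I, -1, -Complex.I]

theorem Omega_mul_OmegaInv : Omega * OmegaInv = 1 := by
  rw [Omega_eq, OmegaInv]
  ext i j
  fin_cases i <;> fin_cases j <;>
    simp [Matrix.mul_apply, Fin.sum_univ_four] <;> ring_nf <;> simp <;> norm_num

theorem det_O0_ne_zero {c : Fin 4 → ℝ} (k : Fin 4 → ℝ) (l : ℂ) (hc : ∀ i, 0 < c i) :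
    (O0 c k l).det ≠ 0 := by
  rw [O0, Matrix.det_mul]
  refine mul_ne_zero ?_ ?_
  · rw [h, Matrix.det_diagonal]
    exact Finset.prod_ne_zero_iff.2 fun i _ => hVec_ne_zero k l hc i
  · intro h0
    have := congrArg Matrix.det Omega_mul_OmegaInv
    rw [Matrix.det_mul, h0, zero_mul, Matrix.det_one] at this
    exact zero_ne_one this

/-- The coefficients of the formal fundamental solution in the gauge of the model system: the
columns are the rotations of the recessive formal solution, rewritten as series in `λ = t / x`. -/
def formalMatrix (c k : Fin 4 → ℝ) (l : ℂ) (q : ℕ) : Matrix (Fin 4) (Fin 4) ℂ :=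
  Matrix.of fun i j =>
    colRot j ^ (i : ℕ) * formalCoeff (mVec k) q i * (colRot j * t c k l)⁻¹ ^ q

theorem O0_mul_apply (c k : Fin 4 → ℝ) (l : ℂ) (X : Matrix (Fin 4) (Fin 4) ℂ) (i j : Fin 4) :
    (O0 c k l * (OmegaInv * X)) i j = hVec c k l i * X i j := by
  rw [O0, Matrix.mul_assoc, ← Matrix.mul_assoc Omega, Omega_mul_OmegaInv, Matrix.one_mul, h,
    Matrix.diagonal_mul]
  rfl

theorem formalMatrix_zero (c k : Fin 4 → ℝ) (l : ℂ) : formalMatrix c k l 0 = Omega := by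
  ext i j
  simp only [formalMatrix, Matrix.of_apply, pow_zero, mul_one]
  rw [colRot_eq, Omega, Matrix.of_apply, omegaPow_natCast, omegaPow_natCast, mul_comm (i : ℕ),
    pow_mul]
  fin_cases i <;> (simp [formalCoeff]; try ring)

theorem formalMatrix_succ {c k : Fin 4 → ℝ} {l : ℂ} (ht : t c k l ≠ 0) (q : ℕ) (i j : Fin 4) :
    t c k l * colRot j * formalMatrix c k l (q + 1) i j
      + t c k l * formalMatrix c k l (q + 1) (i + 1) j
      = (mVec k i - q) * formalMatrix c k l q i j := by
  simp only [formalMatrix, Matrix.of_apply]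
  rw [pow_fin_succ (colRot_pow_four j), pow_succ (colRot j * t c k l)⁻¹]
  have h := formalCoeff_succ (sum_mVec k) q i
  have hj := colRot_ne_zero j
  have h2 : t c k l * colRot j * (colRot j * t c k l)⁻¹ = 1 := by field_simp
  linear_combination (colRot j ^ (i : ℕ) * (colRot j * t c k l)⁻¹ ^ q) * h
    + (colRot j ^ (i : ℕ) * (colRot j * t c k l)⁻¹ ^ q) *
      (formalCoeff (mVec k) (q + 1) i + formalCoeff (mVec k) (q + 1) (i + 1)) * h2

theorem isFormalSolution_formalMatrix {c k : Fin 4 → ℝ} {l : ℂ} (hc : ∀ i, 0 < c i)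
    (hc13 : c 1 = c 3) (hk13 : k 1 = k 3) (ht : t c k l ≠ 0) :
    IsFormalSolution c k l fun q => OmegaInv * formalMatrix c k l q := by
  have hd4 : ∀ (X : Matrix (Fin 4) (Fin 4) ℂ) i j, (X * d4) i j = -(X i j * colRot j) := by
    intro X i j
    rw [d4, Matrix.mul_diagonal, colRot_eq]
    ring
  refine ⟨?_, ?_, fun q => ?_⟩
  · show OmegaInv * formalMatrix c k l 0 = 1
    rw [formalMatrix_zero]
    exact mul_eq_one_comm.1 Omega_mul_OmegaInv
  · ext i j
    rw [Matrix.smul_apply, Matrix.smul_apply, hd4, etaTranspose_mul_apply, O0_mul_apply,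
      O0_mul_apply, smul_eq_mul, smul_eq_mul]
    have h1 := eta_hVec l hc hc13 hk13 i
    have h2 : colRot j * formalMatrix c k l 0 i j + formalMatrix c k l 0 (i + 1) j = 0 := by
      simp only [formalMatrix, Matrix.of_apply, pow_zero, mul_one]
      rw [pow_fin_succ (colRot_pow_four j)]
      have h0 : formalCoeff (mVec k) 0 i + formalCoeff (mVec k) 0 (i + 1) = 0 := by
        fin_cases i <;> simp [formalCoeff]
      linear_combination colRot j * colRot j ^ (i : ℕ) * h0
    linear_combination formalMatrix c k l 0 (i + 1) j * h1 + t c k l * hVec c k l i * h2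
  · ext i j
    rw [Matrix.sub_apply, Matrix.add_apply, Matrix.smul_apply, Matrix.smul_apply, Matrix.smul_apply,
      hd4, etaTranspose_mul_apply, m_mul_apply, O0_mul_apply, O0_mul_apply, O0_mul_apply,
      smul_eq_mul, smul_eq_mul, smul_eq_mul]
    have h1 := eta_hVec l hc hc13 hk13 i
    have h2 := formalMatrix_succ ht q i j
    linear_combination formalMatrix c k l (q + 1) (i + 1) j * h1 + hVec c k l i * h2

/-- The matrix function with columns `h Z_j`, in the coordinate `u = log λ = log t - w`. -/
def gaugeTransform (c k : Fin 4 → ℝ) (l : ℂ) (Z : Fin 4 → ℂ → Fin 4 → ℂ) (u : ℂ) :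
    Matrix (Fin 4) (Fin 4) ℂ :=
  Matrix.of fun i j => hVec c k l i * Z j (Real.log (t c k l).re - u) i

theorem isCanonicalSolution_gaugeTransform {c k : Fin 4 → ℝ} {l : ℂ} (hc : ∀ i, 0 < c i)
    (hc13 : c 1 = c 3) (hk13 : k 1 = k 3) (ht : 0 < (t c k l).re ∧ (t c k l).im = 0) {κ : ℝ}
    {Z : Fin 4 → ℂ → Fin 4 → ℂ}
    (hZ : ∀ j : Fin 4, IsModelCanonical (mVec k) ((j : ℤ) - 2) (-(Real.pi / 2) + (κ - 1) * Real.pi)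
      (3 * Real.pi / 4 + (κ - 1) * Real.pi) (Z j)) :
    IsCanonicalSolution c k l κ (gaugeTransform c k l Z) := by
  obtain ⟨ht0, ht1⟩ := ht
  have htr : t c k l = ((t c k l).re : ℂ) := Complex.ext rfl (by simpa using ht1)
  have htne : t c k l ≠ 0 := by
    intro h0
    rw [h0] at ht0
    simp at ht0
  have hexp : ∀ u : ℂ, Complex.exp (Real.log (t c k l).re - u) = t c k l / Complex.exp u := by
    intro u
    rw [Complex.exp_sub, ← Complex.ofReal_exp, Real.exp_log ht0, ← htr]
  refine ⟨fun u _ i j => ?_, _, isFormalSolution_formalMatrix hc hc13 hk13 htne, ?_⟩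
  · have h1 : HasDerivAt (fun v : ℂ => (Real.log (t c k l).re : ℂ) - v) (-1) u := by
      simpa using (hasDerivAt_id u).const_sub (Real.log (t c k l).re : ℂ)
    have h2 := (((hZ j).1 (Real.log (t c k l).re - u) i).comp u h1).const_mul (hVec c k l i)
    convert! h2 using 1
    have hu := Complex.exp_ne_zero u
    have h3 := eta_hVec l hc hc13 hk13 i
    rw [coeff, Matrix.smul_apply, Matrix.add_mul, Matrix.add_apply, Matrix.smul_mul,
      Matrix.smul_mul, Matrix.smul_apply, Matrix.smul_apply, etaTranspose_mul_apply, m_mul_apply,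
      hexp]
    simp only [gaugeTransform, Matrix.of_apply, smul_eq_mul]
    have h4 : Complex.exp u * (-(4 / (N k : ℂ)) * (Complex.exp l / Complex.exp u ^ 2) *
          (p c k l (i + 1) * (hVec c k l (i + 1) * Z j (Real.log (t c k l).re - u) (i + 1)))
        + 1 / Complex.exp u * (mVec k i * (hVec c k l i * Z j (Real.log (t c k l).re - u) i)))
        = -(4 / N k * Complex.exp l * p c k l (i + 1) * hVec c k l (i + 1))
            * Z j (Real.log (t c k l).re - u) (i + 1) / Complex.exp u
          + mVec k i * (hVec c k l i * Z j (Real.log (t c k l).re - u) i) := by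
      field_simp
    rw [neg_mul] at h4 ⊢
    rw [h4, h3]
    ring
  · intro a b hab n i j
    rcases lt_or_ge b a with hba | hba
    · have : zeroInSubsector a b = ⊥ := by
        rw [zeroInSubsector]
        have : {u : ℂ | a ≤ u.im ∧ u.im ≤ b} = ∅ :=
          eq_empty_of_forall_notMem fun u hu => absurd (hu.1.trans hu.2) (not_le.2 hba)
        rw [this, principal_empty, inf_bot_eq]
      rw [this]
      exact .of_bound 0 eventually_bot
    have ha := hab a ⟨le_rfl, hba⟩
    have hb := hab b ⟨hba, le_rfl⟩
    simp only [sector, mem_ofPred_eq, Complex.mul_im, Complex.ofReal_re, Complex.I_im, mul_one,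
      Complex.ofReal_im, Complex.I_re, mul_zero, add_zero] at ha hb
    obtain ⟨K, R, hK⟩ := (hZ j).2 (-b) (-a) (by linarith [hb.2]) (by linarith [ha.1]) n
    have hpos : 0 < (t c k l).re⁻¹ := inv_pos.2 ht0
    refine Asymptotics.IsBigO.of_bound (‖hVec c k l i‖ * (K * (t c k l).re⁻¹ ^ n)) ?_
    rw [zeroInSubsector, eventually_inf_principal]
    refine (((eventually_le_atBot (Real.log (t c k l).re - R)).comap Complex.re)).mono
      fun u hu hu' => ?_
    have h1 := hK (Real.log (t c k l).re - u)
      (by simp only [Complex.sub_re, Complex.ofReal_re]; linarith)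
      (by simp only [Complex.sub_im, Complex.ofReal_im]; linarith [hu'.2])
      (by simp only [Complex.sub_im, Complex.ofReal_im]; linarith [hu'.1]) i
    have h2 : (gaugeTransform c k l Z u * Matrix.diagonal fun r : Fin 4 =>
            Complex.exp (-(t c k l / Complex.exp u * omegaPow (r.val : ℝ)))) i j
          - (O0 c k l * ∑ q ∈ Finset.range n,
              Complex.exp u ^ q • (OmegaInv * formalMatrix c k l q)) i j
        = hVec c k l i * (Complex.exp (colRot j * Complex.exp (Real.log (t c k l).re - u))
            * Z j (Real.log (t c k l).re - u) i
          - ∑ q ∈ Finset.range n, colRot j ^ (i : ℕ) * formalCoeff (mVec k) q i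
            * (colRot j * Complex.exp (Real.log (t c k l).re - u))⁻¹ ^ q) := by
      have h3 : ∑ q ∈ Finset.range n, Complex.exp u ^ q • (OmegaInv * formalMatrix c k l q)
          = OmegaInv * ∑ q ∈ Finset.range n, Complex.exp u ^ q • formalMatrix c k l q := by
        rw [Matrix.mul_sum]
        exact Finset.sum_congr rfl fun q _ => (Matrix.mul_smul _ _ _).symm
      rw [h3, O0_mul_apply, Matrix.mul_diagonal, mul_sub, hexp]
      congr 1
      · simp only [gaugeTransform, Matrix.of_apply, colRot_eq]
        rw [mul_comm (t c k l / Complex.exp u), neg_mul]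
        ring
      · congr 1
        rw [Matrix.sum_apply]
        refine Finset.sum_congr rfl fun q _ => ?_
        simp only [Matrix.smul_apply, formalMatrix, Matrix.of_apply, smul_eq_mul]
        have h4 : (colRot j * (t c k l / Complex.exp u))⁻¹
            = Complex.exp u * (colRot j * t c k l)⁻¹ := by
          rw [← mul_div_assoc, inv_div, div_eq_mul_inv]
        rw [h4, mul_pow]
        ring
    rw [h2, norm_mul, mul_assoc]
    refine mul_le_mul_of_nonneg_left (h1.trans (le_of_eq ?_)) (norm_nonneg _)
    rw [norm_pow, Complex.norm_exp, mul_assoc, ← mul_pow]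
    congr 2
    simp only [Complex.sub_re, Complex.ofReal_re]
    rw [neg_sub, Real.exp_sub, Real.exp_log ht0]
    ring

/-! ### Uniqueness of canonical solutions -/

/-- The inverse of the exponential factor `exp ((t/λ) d_4)`. -/
def expFactorInv (c k : Fin 4 → ℝ) (l u : ℂ) : Matrix (Fin 4) (Fin 4) ℂ :=
  Matrix.diagonal fun r : Fin 4 => Complex.exp (-(t c k l / Complex.exp u * omegaPow (r.val : ℝ)))

theorem mem_sector_add {κ θ : ℝ} (hθ : (θ : ℂ) * Complex.I ∈ sector κ) (s : ℝ) :
    (s + θ * Complex.I : ℂ) ∈ sector κ := by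
  simpa [sector] using hθ

theorem convex_sector (κ : ℝ) : Convex ℝ (sector κ) :=
  (convex_halfSpace_im_gt _).inter (convex_halfSpace_im_lt _)

theorem tendsto_of_hasExpansion {c k : Fin 4 → ℝ} {l : ℂ} {κ : ℝ}
    {C : ℕ → Matrix (Fin 4) (Fin 4) ℂ} {Φ : ℂ → Matrix (Fin 4) (Fin 4) ℂ} (hC : C 0 = 1)
    (hΦ : HasExpansion c k l κ C Φ) {θ : ℝ} (hθ : (θ : ℂ) * Complex.I ∈ sector κ) :
    Tendsto (fun s : ℝ => Φ (s + θ * Complex.I) * expFactorInv c k l (s + θ * Complex.I)) atBot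
      (𝓝 (O0 c k l)) := by
  refine tendsto_pi_nhds.2 fun i => tendsto_pi_nhds.2 fun j => ?_
  have h1 := hΦ θ θ (fun x hx => by rwa [le_antisymm hx.2 hx.1]) 1 i j
  have hpath : Tendsto (fun s : ℝ => (s + θ * Complex.I : ℂ)) atBot (zeroInSubsector θ θ) := by
    refine tendsto_inf.2 ⟨tendsto_comap_iff.2 ?_, tendsto_principal.2 (Eventually.of_forall ?_)⟩
    · convert! tendsto_id using 1
      funext s
      simp
    · intro s
      simp
  have h2 := h1.comp_tendsto hpath
  have h3 : Tendsto (fun s : ℝ => Complex.exp (s + θ * Complex.I) ^ 1) atBot (𝓝 0) := by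
    rw [tendsto_zero_iff_norm_tendsto_zero]
    simpa [Complex.norm_exp] using Real.tendsto_exp_atBot
  have h4 := h2.trans_tendsto h3
  have h5 := h4.add_const ((O0 c k l) i j)
  simpa [Function.comp_def, expFactorInv, hC] using h5

theorem eventually_det_ne_zero {c k : Fin 4 → ℝ} {l : ℂ} (hc : ∀ i, 0 < c i) {κ : ℝ}
    {Φ : ℂ → Matrix (Fin 4) (Fin 4) ℂ} (hΦ : IsCanonicalSolution c k l κ Φ) {θ : ℝ}
    (hθ : (θ : ℂ) * Complex.I ∈ sector κ) :
    ∀ᶠ s : ℝ in atBot, (Φ (s + θ * Complex.I)).det ≠ 0 := by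
  obtain ⟨_, C, hC, hexp⟩ := hΦ
  have h1 := ((continuous_id.matrix_det).tendsto (O0 c k l)).comp
    (tendsto_of_hasExpansion hC.1 hexp hθ)
  filter_upwards [h1.eventually_ne (det_O0_ne_zero k l hc)] with s hs h0
  apply hs
  simp [Matrix.det_mul, h0]

/-- A fundamental solution of the system of `\hat ω` that is entire in `u = log λ`; every canonical
solution is a constant multiple of it in its sector. -/
theorem exists_system_fundamental (c k : Fin 4 → ℝ) (l : ℂ) :
    ∃ W V : ℂ → Matrix (Fin 4) (Fin 4) ℂ, (∀ u, W u * V u = 1) ∧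
      ∀ κ Φ, IsCanonicalSolution c k l κ Φ → ∃ M, ∀ u ∈ sector κ, Φ u = W u * M := by
  obtain ⟨W, V, -, hV, hVW, hWV⟩ := exists_fundamental_matrix
    (A := fun u => Complex.exp u • coeff c k l (Complex.exp u)) (fun i j => by
      simp only [coeff, Matrix.smul_apply, Matrix.add_apply, smul_eq_mul]
      fun_prop (disch := simp))
  refine ⟨W, V, hWV, fun κ Φ hΦ => ?_⟩
  have hconst : ∀ u ∈ sector κ, ∀ u' ∈ sector κ, V u * Φ u = V u' * Φ u' := by
    intro u hu u' hu'
    ext i j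
    refine eq_of_hasDerivAt_zero_of_convex (f := fun u => (V u * Φ u) i j) (convex_sector κ)
      (fun v hv => ?_) hu hu'
    convert! hasDerivAt_matrix_mul
      (X' := fun u => -(V u * (Complex.exp u • coeff c k l (Complex.exp u))))
      (Y' := fun u => Complex.exp u • (coeff c k l (Complex.exp u) * Φ u)) (hV v) (hΦ.1 v hv) i j
      using 1
    simp [Matrix.mul_assoc]
  rcases (sector κ).eq_empty_or_nonempty with he | ⟨u₀, hu₀⟩
  · exact ⟨0, fun u hu => absurd hu (by simp [he])⟩
  · refine ⟨V u₀ * Φ u₀, fun u hu => ?_⟩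
    rw [← hconst u hu u₀ hu₀, ← Matrix.mul_assoc, hWV, Matrix.one_mul]

/-- The opening of the Stokes sector is larger than `π`. So for each pair of exponential factors the
sector contains a direction in which the first does not decay against the second, and no multiple of
one column can be added to another one without spoiling the asymptotics. -/
theorem canonicalSolution_unique {c k : Fin 4 → ℝ} {l : ℂ} (hc : ∀ i, 0 < c i)
    (ht : 0 < (t c k l).re ∧ (t c k l).im = 0) {κ : ℝ} {Φ Ψ : ℂ → Matrix (Fin 4) (Fin 4) ℂ}
    (hΦ : IsCanonicalSolution c k l κ Φ) (hΨ : IsCanonicalSolution c k l κ Ψ) :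
    ∀ u ∈ sector κ, Φ u = Ψ u := by
  have hp := Real.pi_pos
  have htr : t c k l = ((t c k l).re : ℂ) := Complex.ext rfl (by simpa using ht.2)
  obtain ⟨W, V, hWV, hconst⟩ := exists_system_fundamental c k l
  obtain ⟨M, hM⟩ := hconst κ Φ hΦ
  obtain ⟨M', hM'⟩ := hconst κ Ψ hΨ
  let θ₁ : ℝ := -(3 * Real.pi / 4) - (κ - 1) * Real.pi + Real.pi / 8
  have hθ₁ : (θ₁ : ℂ) * Complex.I ∈ sector κ := by
    simp only [sector, mem_ofPred_eq, Complex.mul_im, Complex.ofReal_re, Complex.I_im, mul_one,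
      Complex.ofReal_im, Complex.I_re, mul_zero, add_zero, θ₁]
    constructor <;> linarith
  have hθ₂ : ((θ₁ + Real.pi : ℝ) : ℂ) * Complex.I ∈ sector κ := by
    simp only [sector, mem_ofPred_eq, Complex.mul_im, Complex.ofReal_re, Complex.I_im, mul_one,
      Complex.ofReal_im, Complex.I_re, mul_zero, add_zero, θ₁]
    constructor <;> linarith
  have hdet : IsUnit M'.det := by
    obtain ⟨s, hs⟩ := (eventually_det_ne_zero hc hΨ hθ₁).exists
    rw [hM' _ (mem_sector_add hθ₁ s), Matrix.det_mul] at hs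
    exact isUnit_iff_ne_zero.2 (right_ne_zero_of_mul hs)
  let Q := M'⁻¹ * M
  have hQ : ∀ u ∈ sector κ, Φ u = Ψ u * Q := by
    intro u hu
    rw [hM u hu, hM' u hu, Matrix.mul_assoc, Matrix.mul_nonsing_inv_cancel_left _ _ hdet]
  have hlim : ∀ θ : ℝ, (θ : ℂ) * Complex.I ∈ sector κ → ∀ i j : Fin 4,
      Tendsto (fun s : ℝ => Q i j * Complex.exp (t c k l / Complex.exp (s + θ * Complex.I)
        * (omegaPow (i.val : ℝ) - omegaPow (j.val : ℝ)))) atBot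
        (𝓝 ((1 : Matrix (Fin 4) (Fin 4) ℂ) i j)) := by
    intro θ hθ i j
    obtain ⟨_, C, hC, hexp⟩ := hΦ
    obtain ⟨_, C', hC', hexp'⟩ := hΨ
    have l1 := tendsto_of_hasExpansion hC.1 hexp hθ
    have l2 := tendsto_of_hasExpansion hC'.1 hexp' hθ
    have l3 := ((continuous_id.matrix_adjugate).tendsto (O0 c k l)).comp l2
    have l4 := l3.mul l1
    have l5 := ((continuous_id.matrix_det).tendsto (O0 c k l)).comp l2
    have hdet0 := det_O0_ne_zero k l hc
    have l6 := (tendsto_pi_nhds.1 (tendsto_pi_nhds.1 l4 i) j).div l5 hdet0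
    have e1 : ((id (O0 c k l)).adjugate * O0 c k l) i j / (id (O0 c k l)).det
        = (1 : Matrix (Fin 4) (Fin 4) ℂ) i j := by
      rw [id, Matrix.adjugate_mul, Matrix.smul_apply, smul_eq_mul, mul_div_cancel_left₀ _ hdet0]
    rw [e1] at l6
    refine l6.congr' ?_
    filter_upwards [l5.eventually_ne hdet0] with s hs
    simp only [Function.comp_apply, id] at hs
    simp only [Function.comp_apply, id, Pi.div_apply]
    rw [div_eq_iff hs]
    set u : ℂ := s + θ * Complex.I with hu
    have hmem : u ∈ sector κ := mem_sector_add hθ s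
    clear_value u
    let E : Matrix (Fin 4) (Fin 4) ℂ := Matrix.diagonal fun r : Fin 4 =>
      Complex.exp (t c k l / Complex.exp u * omegaPow (r.val : ℝ))
    have hE : expFactorInv c k l u * E = 1 := by
      rw [expFactorInv, Matrix.diagonal_mul_diagonal, ← Matrix.diagonal_one]
      congr 1
      funext r
      rw [← Complex.exp_add, neg_add_cancel, Complex.exp_zero]
    have e2 : Φ u * expFactorInv c k l u
        = (Ψ u * expFactorInv c k l u) * (E * Q * expFactorInv c k l u) := by
      rw [hQ u hmem]
      calc Ψ u * Q * expFactorInv c k l u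
          = Ψ u * (expFactorInv c k l u * E) * Q * expFactorInv c k l u := by
            rw [hE, Matrix.mul_one]
        _ = _ := by simp only [Matrix.mul_assoc]
    rw [e2, ← Matrix.mul_assoc, Matrix.adjugate_mul, Matrix.smul_mul, Matrix.one_mul,
      Matrix.smul_apply, smul_eq_mul, mul_comm]
    congr 1
    rw [expFactorInv, Matrix.mul_diagonal, Matrix.diagonal_mul, mul_sub, Complex.exp_sub,
      Complex.exp_neg]
    ring
  have hQ1 : Q = 1 := by
    ext i j
    by_cases hij : i = j
    · subst hij
      have := hlim θ₁ hθ₁ i i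
      simp only [sub_self, mul_zero, Complex.exp_zero, mul_one] at this
      exact tendsto_nhds_unique tendsto_const_nhds this
    · rw [Matrix.one_apply_ne hij]
      -- in one of the directions `θ₁` and `θ₁ + π` the exponential factor is at least `1`
      obtain ⟨θ, hθ, hge⟩ : ∃ θ : ℝ, (θ : ℂ) * Complex.I ∈ sector κ ∧
          0 ≤ (Complex.exp (-(θ * Complex.I))
            * (omegaPow (i.val : ℝ) - omegaPow (j.val : ℝ))).re := by
        rcases le_total 0 (Complex.exp (-(θ₁ * Complex.I))
          * (omegaPow (i.val : ℝ) - omegaPow (j.val : ℝ))).re with h0 | h0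
        · exact ⟨θ₁, hθ₁, h0⟩
        · refine ⟨θ₁ + Real.pi, hθ₂, ?_⟩
          have : Complex.exp (-(((θ₁ + Real.pi : ℝ) : ℂ) * Complex.I))
              = -Complex.exp (-(θ₁ * Complex.I)) := by
            rw [Complex.ofReal_add, add_mul, neg_add, ← sub_eq_add_neg, Complex.exp_sub_pi_mul_I]
          rw [this, neg_mul, Complex.neg_re]
          linarith
      have h1 := (hlim θ hθ i j).norm
      rw [Matrix.one_apply_ne hij, norm_zero] at h1
      have h2 : ∀ s : ℝ, ‖Q i j‖ ≤ ‖Q i j * Complex.exp (t c k l / Complex.exp (s + θ * Complex.I)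
        * (omegaPow (i.val : ℝ) - omegaPow (j.val : ℝ)))‖ := by
        intro s
        rw [norm_mul, Complex.norm_exp]
        refine le_mul_of_one_le_right (norm_nonneg _) (Real.one_le_exp ?_)
        have e3 : t c k l / Complex.exp (s + θ * Complex.I)
            * (omegaPow (i.val : ℝ) - omegaPow (j.val : ℝ))
            = (((t c k l).re * Real.exp (-s) : ℝ) : ℂ) * (Complex.exp (-(θ * Complex.I))
              * (omegaPow (i.val : ℝ) - omegaPow (j.val : ℝ))) := by
          rw [div_eq_mul_inv, ← Complex.exp_neg, neg_add, Complex.exp_add, Complex.ofReal_mul,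
            Complex.ofReal_exp, ← htr]
          push_cast
          ring
        rw [e3, Complex.re_ofReal_mul]
        exact mul_nonneg (mul_nonneg ht.1.le (Real.exp_pos _).le) hge
      have h3 : ‖Q i j‖ ≤ 0 := ge_of_tendsto h1 (Eventually.of_forall h2)
      exact norm_le_zero_iff.1 h3
  intro u hu
  rw [hQ u hu, hQ1, Matrix.mul_one]

/-! ### The Stokes matrices -/

/-- If two canonical solutions of consecutive sectors are related by `P₀`, then `P₀` is the only
Stokes matrix. -/
theorem isStokesMatrix_iff {c k : Fin 4 → ℝ} {l : ℂ} (hc : ∀ i, 0 < c i)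
    (ht : 0 < (t c k l).re ∧ (t c k l).im = 0) {κ : ℝ} {Φ Φ' : ℂ → Matrix (Fin 4) (Fin 4) ℂ}
    (hΦ : IsCanonicalSolution c k l κ Φ) (hΦ' : IsCanonicalSolution c k l (κ + 1 / 4) Φ')
    {P₀ : Matrix (Fin 4) (Fin 4) ℂ} (hP : ∀ u, Φ' u = Φ u * P₀) (P : Matrix (Fin 4) (Fin 4) ℂ) :
    IsStokesMatrix c k l κ P ↔ P = P₀ := by
  constructor
  · rintro ⟨Ψ, Ψ', hΨ, hΨ', hΨP⟩
    have hp := Real.pi_pos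
    have m1 : (((1 - κ) * Real.pi : ℝ) : ℂ) * Complex.I ∈ sector κ := by
      simp only [sector, mem_ofPred_eq, Complex.mul_im, Complex.ofReal_re, Complex.I_im, mul_one,
        Complex.ofReal_im, Complex.I_re, mul_zero, add_zero]
      constructor <;> linarith
    have m2 : (((1 - κ) * Real.pi : ℝ) : ℂ) * Complex.I ∈ sector (κ + 1 / 4) := by
      simp only [sector, mem_ofPred_eq, Complex.mul_im, Complex.ofReal_re, Complex.I_im, mul_one,
        Complex.ofReal_im, Complex.I_re, mul_zero, add_zero]
      constructor <;> linarith
    obtain ⟨s, hs⟩ := (eventually_det_ne_zero hc hΦ m1).exists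
    have n1 := mem_sector_add m1 s
    have n2 := mem_sector_add m2 s
    have h1 := hΨP _ ⟨n1, n2⟩
    rw [canonicalSolution_unique hc ht hΨ hΦ _ n1, canonicalSolution_unique hc ht hΨ' hΦ' _ n2,
      hP] at h1
    have h2 := congrArg (fun X => (Φ (s + ((1 - κ) * Real.pi : ℝ) * Complex.I))⁻¹ * X) h1
    simp only [Matrix.nonsing_inv_mul_cancel_left _ _ (isUnit_iff_ne_zero.2 hs)] at h2
    exact h2.symm
  · rintro rfl
    exact ⟨Φ, Φ', hΦ, hΦ', fun u _ => hP u⟩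

/-- The canonical solutions, in the gauge of the model system, of the sectors `Ω_1`, `Ω_{5/4}` and
`Ω_{3/2}`. -/
theorem exists_stokes_bases (k : Fin 4 → ℝ) :
    ∃ Z₁ Z₂ Z₃ : Fin 4 → ℂ → Fin 4 → ℂ,
      (∀ j : Fin 4, IsModelCanonical (mVec k) ((j : ℤ) - 2) (-(Real.pi / 2)) (3 * Real.pi / 4)
        (Z₁ j)) ∧
      (∀ j : Fin 4, IsModelCanonical (mVec k) ((j : ℤ) - 2) (-(Real.pi / 4)) Real.pi (Z₂ j)) ∧
      (∀ j : Fin 4, IsModelCanonical (mVec k) ((j : ℤ) - 2) 0 (5 * Real.pi / 4) (Z₃ j)) ∧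
      (∀ c l u, gaugeTransform c k l Z₂ u = gaugeTransform c k l Z₁ u * formP1 (stokes1 k)) ∧
      ∀ c l u, gaugeTransform c k l Z₃ u = gaugeTransform c k l Z₂ u * formP54 (stokes2 k) := by
  obtain ⟨G, g2, g1, g0, gp, z1, z2, z3⟩ :=
    exists_model_canonical (sum_mVec k) (monodromy_relation_mVec k)
  have hp := Real.pi_pos
  have q2 : ∀ {A B : ℝ}, -(Real.pi / 4) ≤ A → B ≤ 9 * Real.pi / 4 →
      IsModelCanonical (mVec k) (-2) A B (G (-2)) := fun hA hB => g2.mono hA hB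
  have q1 : ∀ {A B : ℝ}, -(3 * Real.pi / 4) ≤ A → B ≤ 7 * Real.pi / 4 →
      IsModelCanonical (mVec k) (-1) A B (G (-1)) := fun hA hB => g1.mono hA hB
  have q0 : ∀ {A B : ℝ}, -(5 * Real.pi / 4) ≤ A → B ≤ 5 * Real.pi / 4 →
      IsModelCanonical (mVec k) 0 A B (G 0) := fun hA hB => g0.mono hA hB
  refine ⟨![fun w i => G (-2) w i + -(omegaPow (5 / 2) * stokes1 k) * G (-1) w i,
      G (-1), G 0, G 1],
    ![G (-2), G (-1), G 0,
      fun w i => G 1 w i + - -(omegaPow (-1 / 2) * stokes1 k) * G 0 w i],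
    ![G (-2), G (-1), G 0,
      fun w i => (G 1 w i + - -(omegaPow (-1 / 2) * stokes1 k) * G 0 w i)
        + omegaPow 1 * stokes2 k * G (-1) w i], fun j => ?_, fun j => ?_, fun j => ?_,
    fun c l u => ?_, fun c l u => ?_⟩
  · fin_cases j
    · exact z1
    · exact q1 (by linarith) (by linarith)
    · exact q0 (by linarith) (by linarith)
    · exact gp.mono (by linarith) le_rfl
  · fin_cases j
    · exact q2 (by linarith) (by linarith)
    · exact q1 (by linarith) (by linarith)
    · exact q0 (by linarith) (by linarith)
    · exact z2
  · fin_cases j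
    · exact q2 (by linarith) (by linarith)
    · exact q1 (by linarith) (by linarith)
    · exact q0 (by linarith) (by linarith)
    · exact z3
  · ext i j
    fin_cases j <;>
      simp [gaugeTransform, formP1, Matrix.mul_apply, Fin.sum_univ_four] <;> ring
  · ext i j
    fin_cases j <;>
      (simp [gaugeTransform, formP54, Matrix.mul_apply, Fin.sum_univ_four]; try ring)

end

end TTStarToda

theorem theorem3p7 (c k : Fin 4 → ℝ) (l : ℂ)
    (hc : ∀ i, 0 < c i) (hc13 : c 1 = c 3) (hk13 : k 1 = k 3)
    (hN : TTStarToda.N k ≠ 0)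
    (ht : 0 < (TTStarToda.t c k l).re ∧ (TTStarToda.t c k l).im = 0) :
    (∀ P : Matrix (Fin 4) (Fin 4) ℂ,
      TTStarToda.IsStokesMatrix c k l 1 P ↔
        P = TTStarToda.formP1
          (2 * Real.cos (Real.pi / 4 * (2 * TTStarToda.m0 k + 3))
            + 2 * Real.cos (Real.pi / 4 * (2 * TTStarToda.m1 k + 1)))) ∧
    (∀ P : Matrix (Fin 4) (Fin 4) ℂ,
      TTStarToda.IsStokesMatrix c k l (5 / 4) P ↔
        P = TTStarToda.formP54
          (-2 + 2 * Real.cos (Real.pi / 2 * (TTStarToda.m0 k + TTStarToda.m1 k))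
            + 2 * Real.sin (Real.pi / 2 * (TTStarToda.m0 k - TTStarToda.m1 k)))) := by
  obtain ⟨Z₁, Z₂, Z₃, h₁, h₂, h₃, hP₁, hP₂⟩ := TTStarToda.exists_stokes_bases k
  have hcan : ∀ (κ A B : ℝ) (Z : Fin 4 → ℂ → Fin 4 → ℂ),
      (∀ j : Fin 4, TTStarToda.IsModelCanonical (TTStarToda.mVec k) ((j : ℤ) - 2) A B (Z j)) →
      A = -(Real.pi / 2) + (κ - 1) * Real.pi → B = 3 * Real.pi / 4 + (κ - 1) * Real.pi →
      TTStarToda.IsCanonicalSolution c k l κ (TTStarToda.gaugeTransform c k l Z) := by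
    rintro κ A B Z hZ rfl rfl
    exact TTStarToda.isCanonicalSolution_gaugeTransform hc hc13 hk13 ht hZ
  exact ⟨TTStarToda.isStokesMatrix_iff hc ht (hcan _ _ _ Z₁ h₁ (by ring) (by ring))
      (hcan _ _ _ Z₂ h₂ (by ring) (by ring)) (hP₁ c l),
    TTStarToda.isStokesMatrix_iff hc ht (hcan _ _ _ Z₂ h₂ (by ring) (by ring))
      (hcan _ _ _ Z₃ h₃ (by ring) (by ring)) (hP₂ c l)⟩
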